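/- Let $d,n\ge 1$, $L,\tau>0$, let $f_1,\dots,f_n:\mathbb R^d\to\mathbb R$ be convex, differentiable and $L$-smooth (i.e. $\|\nabla f_i(x)-\nabla f_i(y)\|\le L\|x-y\|$), and let $f=\frac1n\sum_{i=1}^n f_i$ be $\tau$-strongly convex, i.e. $f(y)\ge f(x)+\langle\nabla f(x),y-x\rangle+\frac\tau2\|y-x\|^2$ for all $x,y$. Put $f^*=\min f$ and, for $\mu>0$, $f_\mu(x)=\mathbb E_{u\sim N(0,I_d)}[f(x+\mu u)]$, $x_\mu^*=\arg\min f_\mu$, and, for a starting point $x^0$, $$D_0=\tfrac{2}{d+4}\,[f_\mu(x^0)-f_\mu(x_\mu^*)]+6L\|x^0-x_\mu^*\|^2 .$$ ZO-Varag accesses the $f_i$ only through queries of values $f_i(x)$. With smoothing parameters $\mu,\nu>0$ put $g_\mu(x,u,i)=\frac{f_i(x+\mu u)-f_i(x)}{\mu}u$ and $g_\nu(x)=\frac1n\sum_{i=1}^n\sum_{j=1}^d\frac{f_i(x+\nu e_j)-f_i(x-\nu e_j)}{2\nu}e_j$, and let $\tilde x^0=x^0$. Epoch $s=1,2,\dots$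 sets $\tilde x=\tilde x^{s-1}$, $x_0=x^{s-1}$, $\bar x_0=\tilde x$, $\tilde g=g_\nu(\tilde x)$, and for $t=1,\dots,T_s$, with fresh independent $u_t\sim N(0,I_d)$ and $i_t$ uniform on $\{1,\dots,n\}$, $$\underline x_t=\frac{(1+\tau\gamma_s)(1-\alpha_s-p_s)\bar x_{t-1}+\alpha_s x_{t-1}+(1+\tau\gamma_s)p_s\tilde x}{1+\tau\gamma_s(1-\alpha_s)},\qquad G_t=g_\mu(\underline x_t,u_t,i_t)-g_\mu(\tilde x,u_t,i_t)+\tilde g,$$ $$x_t=\arg\min_{x}\Big\{\gamma_s\big[\langle G_t,x\rangle+\tfrac\tau2\|\underline x_t-x\|^2\big]+\tfrac12\|x_{t-1}-x\|^2\Big\},\qquad \bar x_t=(1-\alpha_s-p_s)\bar x_{t-1}+\alpha_s x_t+p_s\tilde x ;$$ then $x^s=x_{T_s}$ and $\tilde x^s=\sum_{t=1}^{T_s}\theta_t\bar x_t\big/\sum_{t=1}^{T_s}\theta_t$. The output after $S$ epochs is $\tilde x^S$. The parameters are as follows, with $s_0=\lfloor\log_2((d+4)n)\rfloor+1$: $T_s=2^{\min(s,s_0)-1}$,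 $p_s=\frac12$, $\gamma_s=\frac1{12(d+4)L\alpha_s}$; $\alpha_s=\frac12$ for $s\le s_0$ and $\alpha_s=\min\{\sqrt{n\tau/(24L)},\frac12\}$ for $s>s_0$. For $s\le s_0$, $\theta_t=\frac{\gamma_s}{\alpha_s}(\alpha_s+p_s)$ if $t<T_s$ and $\theta_{T_s}=\frac{\gamma_s}{\alpha_s}$; for $s>s_0$, with $\Gamma_t=(1+\frac{\tau\gamma_s}2)^t$, $\theta_t=\Gamma_{t-1}-(1-\alpha_s-p_s)\Gamma_t$ if $t<T_s$ and $\theta_{T_s}=\Gamma_{T_s-1}$. Then there is a universal constant $C$ such that for all $d,n,L,\tau$ as above and every $\epsilon>0$ there are thresholds $\mu_{\max},\nu_{\max}>0$, depending only on $d,n,L,\tau,\epsilon$, such that for all $f_1,\dots,f_n$ and $x^0$ as above and all $0<\mu\le\mu_{\max}$, $0<\nu\le\nu_{\max}$, there is a number of epochs $S$ for which ZO-Varag outputs a stochastic $\epsilon$-solution, $\mathbb E[f(\tilde x^S)-f^*]\le\epsilon$, after a total number of function queries of at most $$C\,dn\,\max\Big\{1,\log\tfrac{dD_0}{\epsilon}\Big\}\quad\text{if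 } n\ge D_0/\epsilon\text{ or } n\ge 6L/\tau,$$ $$C\Big(dn\,\max\{1,\log(dn)\}+d\sqrt{\tfrac{nL}{\tau}}\,\log\tfrac{D_0}{n\epsilon}\Big)\quad\text{if } n<D_0/\epsilon\text{ and } n<6L/\tau .$$ (In the first case $\log\frac{dD_0}{\epsilon}$ is read as $-\infty$ if $D_0=0$.) -/

import Mathlib

open MeasureTheory ProbabilityTheory Set

/-- The space `ℝ^d` with its Euclidean norm and scalar product. -/
abbrev Eucl (d : ℕ) : Type := EuclideanSpace ℝ (Fin d)

namespace ZOVarag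

noncomputable section

/-! ### Programs with access to function values, and their number of queries -/

/-- A program that sees the component functions `f_i` only by querying values `f_i(x)`:
either it stops with a result, or it asks for the value of component `i` at the point `x` and goes
on with the answer. -/
inductive QueryProg (ι X α : Type) : Type
  | done (a : α) : QueryProg ι X α
  | query (i : ι) (x : X) (k : ℝ → QueryProg ι X α) : QueryProg ι X α

namespace QueryProg

variable {ι X α β : Type}

/-- Sequential composition. -/
def bind : QueryProg ι X α → (α → QueryProg ι X β) → QueryProg ι X β
  | done a, g => g a
  | query i x k, g => query i x (fun r => (k r).bind g)

instance : Monad (QueryProg ι X) where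
  pure := done
  bind := bind

/-- The single query of `f_i(x)`. -/
def ask (i : ι) (x : X) : QueryProg ι X ℝ := query i x done

/-- The result of a program when the queries are answered by the functions `f`. -/
def eval (f : ι → X → ℝ) : QueryProg ι X α → α
  | done a => a
  | query i x k => (k (f i x)).eval f

/-- The number of queries that a program makes when they are answered by the functions `f`. -/
def queries (f : ι → X → ℝ) : QueryProg ι X α → ℕ
  | done _ => 0
  | query i x k => (k (f i x)).queries f + 1

/-- Run `m` programs in turn and add up their results. -/
def sum [AddCommMonoid α] : (m : ℕ) → (Fin m → QueryProg ι X α) → QueryProg ι X α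
  | 0, _ => pure 0
  | m + 1, g => do
      let a ← sum m (fun j => g j.castSucc)
      let b ← g (Fin.last m)
      pure (a + b)

end QueryProg

/-! ### The objective function, its smoothing and the assumptions -/

variable {d n : ℕ}

/-- The objective `f = (1/n) ∑ i, f_i`. -/
def objective (f : Fin n → Eucl d → ℝ) (x : Eucl d) : ℝ := (1 / (n : ℝ)) * ∑ i, f i x

/-- The Gaussian smoothing `g_μ(x) = E_u[g(x + μ u)]`, with `u ∼ N(0, I_d)`. -/
def smoothing (μ : ℝ) (g : Eucl d → ℝ) (x : Eucl d) : ℝ :=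
  ∫ u, g (x + μ • u) ∂(stdGaussian (Eucl d))

/-- Each `f_i` is convex, differentiable and `L`-smooth. -/
structure SmoothConvex (f : Fin n → Eucl d → ℝ) (L : ℝ) : Prop where
  convex : ∀ i, ConvexOn ℝ univ (f i)
  differentiable : ∀ i, Differentiable ℝ (f i)
  smooth : ∀ i x y, ‖gradient (f i) x - gradient (f i) y‖ ≤ L * ‖x - y‖

/-- A differentiable function `g` is `τ`-strongly convex. -/
def StronglyConvex (g : Eucl d → ℝ) (τ : ℝ) : Prop :=
  ∀ x y, g x + inner ℝ (gradient g x) (y - x) + τ / 2 * ‖y - x‖ ^ 2 ≤ g y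

/-! ### The parameters of the method -/

/-- `s₀ = ⌊log₂ ((d+4) n)⌋ + 1`. -/
def s₀ (d n : ℕ) : ℕ := Nat.log 2 ((d + 4) * n) + 1

/-- The number `T_s` of inner iterations of epoch `s ≥ 1`. -/
def epochLength (d n s : ℕ) : ℕ := if s ≤ s₀ d n then 2 ^ (s - 1) else 2 ^ (s₀ d n - 1)

/-- `α_s`. -/
def alpha (d n : ℕ) (L τ : ℝ) (s : ℕ) : ℝ :=
  if s ≤ s₀ d n then 1 / 2 else min (Real.sqrt (n * τ / (24 * L))) (1 / 2)

/-- `γ_s = 1 / (12 (d+4) L α_s)`. -/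
def gamma (d n : ℕ) (L τ : ℝ) (s : ℕ) : ℝ := 1 / (12 * (d + 4) * L * alpha d n L τ s)

/-- `p_s = 1/2`. -/
def pWeight : ℝ := 1 / 2

/-- `Γ_t = (1 + τ γ_s / 2)^t` in epoch `s`. -/
def bigGamma (d n : ℕ) (L τ : ℝ) (s t : ℕ) : ℝ := (1 + τ * gamma d n L τ s / 2) ^ t

/-- The averaging weight `θ_t`, `1 ≤ t ≤ T_s`, of epoch `s`. -/
def theta (d n : ℕ) (L τ : ℝ) (s t : ℕ) : ℝ :=
  if s ≤ s₀ d n then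
    if t < epochLength d n s then
      gamma d n L τ s / alpha d n L τ s * (alpha d n L τ s + pWeight)
    else gamma d n L τ s / alpha d n L τ s
  else
    if t < epochLength d n s then
      bigGamma d n L τ s (t - 1) - (1 - alpha d n L τ s - pWeight) * bigGamma d n L τ s t
    else bigGamma d n L τ s (t - 1)

/-! ### The method -/

/-- Programs that query the values of `f_1, …, f_n` on `ℝ^d`. -/
abbrev Prog (d n : ℕ) (α : Type) : Type := QueryProg (Fin n) (Eucl d) α

/-- The Gaussian estimator `g_μ(x,u,i) = ((f_i(x + μ u) - f_i(x)) / μ) u`. -/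
def gaussianEstimator (μ : ℝ) (x u : Eucl d) (i : Fin n) : Prog d n (Eucl d) := do
  let a ← QueryProg.ask i (x + μ • u)
  let b ← QueryProg.ask i x
  pure (((a - b) / μ) • u)

/-- The coordinate-wise estimator
`g_ν(x,i) = ∑ j, ((f_i(x + ν e_j) - f_i(x - ν e_j)) / (2 ν)) e_j`. -/
def coordEstimator (ν : ℝ) (x : Eucl d) (i : Fin n) : Prog d n (Eucl d) :=
  QueryProg.sum d fun j => do
    let a ← QueryProg.ask i (x + ν • EuclideanSpace.single j (1 : ℝ))
    let b ← QueryProg.ask i (x - ν • EuclideanSpace.single j (1 : ℝ))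
    pure (((a - b) / (2 * ν)) • EuclideanSpace.single j (1 : ℝ))

/-- The full coordinate-wise estimator `g_ν(x) = (1/n) ∑ i, g_ν(x,i)`. -/
def pivotalGradient (ν : ℝ) (x : Eucl d) : Prog d n (Eucl d) := do
  let g ← QueryProg.sum n fun i => coordEstimator ν x i
  pure ((1 / (n : ℝ)) • g)

/-- One inner iteration of an epoch with parameters `α, p, γ`, pivot `xt = x̃` and pivotal gradient
`gt`, from `(x_{t-1}, x̄_{t-1})` to `(x_t, x̄_t)`, with sampled direction `u` and component `i`.
The point `x_t` is the minimiser of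
`y ↦ γ (⟨G_t, y⟩ + (τ/2) ‖x̲_t - y‖²) + (1/2) ‖x_{t-1} - y‖²`. -/
def innerStep (τ μ α p γ : ℝ) (xt gt : Eucl d) (x xbar u : Eucl d) (i : Fin n) :
    Prog d n (Eucl d × Eucl d) := do
  let xl : Eucl d := (1 / (1 + τ * γ * (1 - α))) •
    (((1 + τ * γ) * (1 - α - p)) • xbar + α • x + ((1 + τ * γ) * p) • xt)
  let g₁ ← gaussianEstimator μ xl u i
  let g₂ ← gaussianEstimator μ xt u i
  let G : Eucl d := g₁ - g₂ + gt
  let x' : Eucl d := (1 / (1 + γ * τ)) • (x + (γ * τ) • xl - γ • G)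
  let xbar' : Eucl d := (1 - α - p) • xbar + α • x' + p • xt
  pure (x', xbar')

/-- The first `t` inner iterations of an epoch that starts from `x_0 = x`, `x̄_0 = xt = x̃`, with the
samples `ξ 1, ξ 2, …`; the result is `(x_t, x̄_t, ∑_{r ≤ t} θ_r x̄_r)`. -/
def innerLoop (τ μ α p γ : ℝ) (θ : ℕ → ℝ) (ξ : ℕ → Eucl d × Fin n) (xt gt x : Eucl d) :
    ℕ → Prog d n (Eucl d × Eucl d × Eucl d)
  | 0 => pure (x, xt, 0)
  | t + 1 => do
      let (y, ybar, acc) ← innerLoop τ μ α p γ θ ξ xt gt x t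
      let (y', ybar') ← innerStep τ μ α p γ xt gt y ybar (ξ (t + 1)).1 (ξ (t + 1)).2
      pure (y', ybar', acc + θ (t + 1) • ybar')

/-- Epoch `s`, from `(x^{s-1}, x̃^{s-1})` to `(x^s, x̃^s)`; the pivot is `x̃^{s-1}`. -/
def epoch (L τ μ ν : ℝ) (s : ℕ) (ξ : ℕ → Eucl d × Fin n) (x xt : Eucl d) :
    Prog d n (Eucl d × Eucl d) := do
  let gt ← pivotalGradient ν xt
  let (y, _, acc) ← innerLoop τ μ (alpha d n L τ s) pWeight (gamma d n L τ s) (theta d n L τ s) ξ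
    xt gt x (epochLength d n s)
  pure (y, (1 / ∑ t ∈ Finset.Icc 1 (epochLength d n s), theta d n L τ s t) • acc)

/-- `S` epochs of the method from `x^0 = x̃^0 = x0`, where `ξ s t = (u_t, i_t)` is the sample
used in iteration `t` of epoch `s`; the result is `(x^S, x̃^S)`. -/
def epochs (L τ μ ν : ℝ) (x0 : Eucl d) (ξ : ℕ → ℕ → Eucl d × Fin n) :
    ℕ → Prog d n (Eucl d × Eucl d)
  | 0 => pure (x0, x0)
  | S + 1 => do
      let (x, xt) ← epochs L τ μ ν x0 ξ S
      epoch L τ μ ν (S + 1) (ξ (S + 1)) x xt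

/-- ZO-Varag with `S` epochs: the output is `x̃^S`. -/
def zoVarag (L τ μ ν : ℝ) (x0 : Eucl d) (S : ℕ) (ξ : ℕ → ℕ → Eucl d × Fin n) :
    Prog d n (Eucl d) := do
  let (_, xt) ← epochs L τ μ ν x0 ξ S
  pure xt

/-- The samples `ξ s t = (u, i)` are independent, with `u ∼ N(0, I_d)` and `i` uniform on the `n`
components, independent of `u`. -/
structure IsSampling {Ω : Type*} [MeasurableSpace Ω] (P : Measure Ω)
    (ξ : ℕ → ℕ → Ω → Eucl d × Fin n) : Prop where
  measurable : ∀ s t, Measurable (ξ s t)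
  law : ∀ s t, P.map (ξ s t) = (stdGaussian (Eucl d)).prod (uniformOn (univ : Set (Fin n)))
  indep : iIndepFun (fun st : ℕ × ℕ => ξ st.1 st.2) P

/-! ### The complexity bound -/

/-- `D₀ = (2/(d+4)) (f_μ(x^0) - f_μ(x_μ^*)) + 6 L ‖x^0 - x_μ^*‖²`, for a minimiser `xs = x_μ^*`
of the smoothed function `f_μ`. -/
def initialGap (f : Fin n → Eucl d → ℝ) (L μ : ℝ) (x0 xs : Eucl d) : ℝ :=
  2 / ((d : ℝ) + 4) * (smoothing μ (objective f) x0 - smoothing μ (objective f) xs)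
    + 6 * L * ‖x0 - xs‖ ^ 2

/-- The bound on the number of queries, up to a constant factor. A logarithm that may be
close to zero or negative is replaced by `1` when it is smaller than `1`. -/
def complexityBound (d n : ℕ) (L τ ε D₀ : ℝ) : ℝ :=
  if D₀ / ε ≤ n ∨ 6 * L / τ ≤ n then
    d * n * max 1 (Real.log (d * D₀ / ε))
  else
    d * n * max 1 (Real.log (d * n)) + d * Real.sqrt (n * L / τ) * Real.log (D₀ / (n * ε))

end

end ZOVarag

/-! The analysis runs on `f` itself and its minimiser `y`; the smoothed function enters only through
`D₀`. The estimator `G_t` is split as `∇f(x̲_t) + m + w`. The part `m` (`noise`) is `⟨∇f_i(x̲_t) -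
∇f_i(x̃), u⟩ u` minus its mean, and `w` collects all finite difference remainders. Since `w` is
bounded by a polynomial in `‖u‖` that depends neither on `f` nor on the points
(`norm_gradEst_sub_le`), it costs only an additive `errLevel`, and the thresholds for `μ` and `ν`
can be fixed before `f` is known. The part `m` has mean zero, and Gaussian fourth moments with
cocoercivity bound its second moment by `6dL` times the Bregman divergence of `f` from `x̲_t` to
`x̃` (`integral_norm_noise_sq_le`). The weight `p = 1/2` on the pivot pays for this: the
linearisation of `f` at `x̲_t`, evaluated at `x̃`, plus that divergence is `f(x̃)`.

The deterministic inequality `prox_step`, integrated over one fresh sample, gives a recursion for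
the expected gaps `a` and expected squared distances `b`. With Jensen for the averaged output,
`EpochBound` records this recursion; what follows is about real sequences.

In the first `s₀` epochs `1 - α - p = 0`, the inner sum telescopes, and the doubling epoch lengths
halve the gap up to `errLevel` (`initial_phase_bound`). Afterwards the weights `Γ_t` make the sum
telescope to a contraction of the potential `A + η D` by `1 + α/2` per epoch
(`EpochBound.second_phase`): averaging gains the factor in `A`, and strong convexity over `T ≥
(d+4)n/2` iterations gains it in `D`.

Each epoch costs `O(dn)` queries, so it remains to choose the number of epochs
(`exists_sufficient`). The delicate point is that `log (D₀/(nε))` in the second regime may be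
arbitrarily close to `0`: near `D₀ = nε` the first phase alone must suffice, which forces a sharp
enough comparison between `D₀` and the corresponding quantity for `f` (`initialGap_comparison`). -/

namespace ZOVarag

noncomputable section

/-! ### Convex functions with Lipschitz gradient -/

section Smooth

variable {E : Type*} [NormedAddCommGroup E] [InnerProductSpace ℝ E] [CompleteSpace E]

lemma hasDerivAt_line {g : E → ℝ} (hg : Differentiable ℝ g) (x v : E) (t : ℝ) :
    HasDerivAt (fun t : ℝ => g (x + t • v)) (inner ℝ (gradient g (x + t • v)) v) t := by
  have h1 : HasDerivAt (fun t : ℝ => x + t • v) v t := by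
    simpa using ((hasDerivAt_id t).smul_const v).const_add x
  have h2 := (hg (x + t • v)).hasFDerivAt.comp_hasDerivAt t h1
  rw [inner_gradient_left]
  exact h2

/-- First order Taylor bound for a function with Lipschitz gradient. -/
lemma abs_sub_sub_inner_gradient_le {g : E → ℝ} {L : ℝ} (hg : Differentiable ℝ g)
    (hL : ∀ x y, ‖gradient g x - gradient g y‖ ≤ L * ‖x - y‖) (x y : E) :
    |g y - g x - inner ℝ (gradient g x) (y - x)| ≤ L / 2 * ‖y - x‖ ^ 2 := by
  set v := y - x with hv
  have hd : ∀ t : ℝ, HasDerivAt (fun t : ℝ => g (x + t • v) - g x - t * inner ℝ (gradient g x) v)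
      (inner ℝ (gradient g (x + t • v)) v - inner ℝ (gradient g x) v) t := fun t => by
    have h := ((hasDerivAt_line hg x v t).sub_const (g x)).sub
      ((hasDerivAt_id t).mul_const (inner ℝ (gradient g x) v))
    rw [one_mul] at h
    exact h
  have hB : ∀ t : ℝ, HasDerivAt (fun t : ℝ => L / 2 * ‖v‖ ^ 2 * t ^ 2) (L * ‖v‖ ^ 2 * t) t :=
    fun t => by
      have := ((hasDerivAt_id t).pow 2).const_mul (L / 2 * ‖v‖ ^ 2)
      refine this.congr_deriv ?_
      simp only [id_eq]; ring
  -- The remainder along the segment vanishes at `0` and its derivative is at most `L ‖v‖² t`, the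
  -- derivative of the barrier `L/2 ‖v‖² t²`.
  have key := image_norm_le_of_norm_deriv_right_le_deriv_boundary (a := 0) (b := 1)
    (f := fun t : ℝ => g (x + t • v) - g x - t * inner ℝ (gradient g x) v)
    (B := fun t : ℝ => L / 2 * ‖v‖ ^ 2 * t ^ 2)
    (fun t _ => (hd t).continuousAt.continuousWithinAt)
    (fun t _ => (hd t).hasDerivWithinAt) (by simp) hB
    (fun t ht => by
      rw [← inner_sub_left]
      refine (norm_inner_le_norm _ _).trans ?_
      have h := hL (x + t • v) x
      rw [add_sub_cancel_left, norm_smul, Real.norm_of_nonneg ht.1] at h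
      nlinarith [norm_nonneg v])
  have h1 := key (right_mem_Icc.2 zero_le_one)
  simpa [hv] using h1

/-- The first order characterisation of convexity. -/
lemma add_inner_gradient_le {g : E → ℝ} (hc : ConvexOn ℝ univ g) (hg : Differentiable ℝ g)
    (x y : E) : g x + inner ℝ (gradient g x) (y - x) ≤ g y := by
  have h1 : ConvexOn ℝ univ (fun t : ℝ => g (x + t • (y - x))) := by
    have := hc.comp_affineMap (AffineMap.lineMap x y : ℝ →ᵃ[ℝ] E)
    refine this.congr fun t _ => ?_
    simp [AffineMap.lineMap_apply, add_comm]
  have h2 := h1.le_slope_of_hasDerivAt (x := 0) (y := 1) (mem_univ _) (mem_univ _) one_pos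
    (hasDerivAt_line hg x (y - x) 0)
  simp only [slope_def_field, zero_smul, add_zero, one_smul, add_sub_cancel, sub_zero, div_one]
    at h2
  linarith

/-- Cocoercivity of the gradient of a smooth convex function. -/
lemma norm_gradient_sub_sq_le {g : E → ℝ} {L : ℝ} (hL0 : 0 < L) (hc : ConvexOn ℝ univ g)
    (hg : Differentiable ℝ g)
    (hL : ∀ x y, ‖gradient g x - gradient g y‖ ≤ L * ‖x - y‖) (x y : E) :
    ‖gradient g x - gradient g y‖ ^ 2 ≤
      2 * L * (g y - g x - inner ℝ (gradient g x) (y - x)) := by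
  set a := gradient g y - gradient g x with ha
  -- The point `y - L⁻¹ a` is a minimising step from `y` for `g` minus its tangent at `x`:
  -- smoothness at `y` bounds `g` there from above, convexity at `x` from below.
  have h1 := (abs_le.1 (abs_sub_sub_inner_gradient_le hg hL y (y - L⁻¹ • a))).2
  have h2 := add_inner_gradient_le hc hg x (y - L⁻¹ • a)
  have e1 : y - L⁻¹ • a - y = -(L⁻¹ • a) := by abel
  have e2 : y - L⁻¹ • a - x = (y - x) - L⁻¹ • a := by abel
  rw [e1, norm_neg, norm_smul, inner_neg_right, inner_smul_right, Real.norm_of_nonneg (by positivity)]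
    at h1
  rw [e2, inner_sub_right, inner_smul_right] at h2
  have h3 : inner ℝ (gradient g y) a - inner ℝ (gradient g x) a = ‖a‖ ^ 2 := by
    rw [← inner_sub_left, ← ha, real_inner_self_eq_norm_sq]
  rw [norm_sub_rev, ← ha]
  have h4 : L⁻¹ * ‖a‖ ^ 2 - L / 2 * (L⁻¹ * ‖a‖) ^ 2 = (2 * L)⁻¹ * ‖a‖ ^ 2 := by
    field_simp; ring
  have h5 : (2 * L)⁻¹ * ‖a‖ ^ 2 ≤ g y - g x - inner ℝ (gradient g x) (y - x) := by
    rw [← h4]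
    have : L⁻¹ * ‖a‖ ^ 2 = L⁻¹ * inner ℝ (gradient g y) a - L⁻¹ * inner ℝ (gradient g x) a := by
      rw [← h3]; ring
    rw [this]; linarith
  rw [inv_mul_le_iff₀ (by positivity)] at h5
  exact h5

end Smooth

/-! ### The averaged objective and existence of minimisers -/

section Objective

variable {d n : ℕ} {f : Fin n → Eucl d → ℝ} {L τ : ℝ}

lemma SmoothConvex.differentiable_objective (hf : SmoothConvex f L) :
    Differentiable ℝ (objective f) := by
  unfold objective
  have := hf.differentiable
  fun_prop

lemma SmoothConvex.gradient_objective (hf : SmoothConvex f L) (x : Eucl d) :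
    gradient (objective f) x = (1 / (n : ℝ)) • ∑ i, gradient (f i) x := by
  have h : HasFDerivAt (objective f) ((1 / (n : ℝ)) • ∑ i, fderiv ℝ (f i) x) x := by
    have := (HasFDerivAt.fun_sum (u := Finset.univ)
      (fun i _ => (hf.differentiable i x).hasFDerivAt)).const_mul (1 / (n : ℝ))
    exact this
  refine HasGradientAt.gradient ?_
  rw [hasGradientAt_iff_hasFDerivAt]
  have e : (InnerProductSpace.toDual ℝ (Eucl d)) ((1 / (n : ℝ)) • ∑ i, gradient (f i) x) =
      (1 / (n : ℝ)) • ∑ i, fderiv ℝ (f i) x := by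
    simp [gradient]
  rw [e]
  exact h

lemma SmoothConvex.convexOn_objective (hf : SmoothConvex f L) :
    ConvexOn ℝ univ (objective f) := by
  have h : ConvexOn ℝ univ (fun x => ∑ i, f i x) := by
    refine ⟨convex_univ, fun x _ y _ a b ha hb hab => ?_⟩
    simp only [smul_eq_mul, Finset.mul_sum, ← Finset.sum_add_distrib]
    exact Finset.sum_le_sum fun i _ =>
      (hf.convex i).2 (mem_univ x) (mem_univ y) ha hb hab
  exact h.smul (by positivity : (0 : ℝ) ≤ 1 / (n : ℝ))

lemma SmoothConvex.gradient_objective_lipschitz (hf : SmoothConvex f L) (hn : 0 < n) (x y : Eucl d) :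
    ‖gradient (objective f) x - gradient (objective f) y‖ ≤ L * ‖x - y‖ := by
  rw [hf.gradient_objective, hf.gradient_objective, ← smul_sub, ← Finset.sum_sub_distrib, norm_smul]
  have h : ‖∑ i, (gradient (f i) x - gradient (f i) y)‖ ≤ n * (L * ‖x - y‖) := by
    refine (norm_sum_le_of_le _ fun i _ => hf.smooth i x y).trans ?_
    simp
  have hn' : (0 : ℝ) < n := by exact_mod_cast hn
  rw [Real.norm_of_nonneg (by positivity), one_div, inv_mul_le_iff₀ hn']
  exact h

/-- A strongly convex minorant makes `g` coercive. Two functions are allowed so that the lemma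
serves both `f` (with `h = g`) and its smoothing, which lies above `f`. -/
lemma StronglyConvex.exists_isMinOn {g : Eucl d → ℝ} (hτ : 0 < τ) (hg : Continuous g)
    {h : Eucl d → ℝ} (hs : StronglyConvex h τ) (hle : ∀ x, h x ≤ g x) :
    ∃ x, IsMinOn g univ x := by
  have hlb : ∀ y, h 0 + ‖y‖ * (τ / 2 * ‖y‖ - ‖gradient h 0‖) ≤ g y := fun y => by
    have h1 := hs 0 y
    have h2 := (abs_le.1 (abs_real_inner_le_norm (gradient h 0) (y - 0))).1
    rw [sub_zero] at h1 h2
    linarith [hle y]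
  have ht : Filter.Tendsto g (Filter.cocompact _) Filter.atTop := by
    refine Filter.tendsto_atTop_mono hlb ?_
    have hn := tendsto_norm_cocompact_atTop (E := Eucl d)
    refine Filter.tendsto_atTop_add_const_left _ _ (hn.atTop_mul_atTop₀ ?_)
    simp only [sub_eq_add_neg]
    exact Filter.tendsto_atTop_add_const_right _ _ (hn.const_mul_atTop (by positivity))
  obtain ⟨x, hx⟩ := hg.exists_forall_le ht
  exact ⟨x, fun y _ => hx y⟩

lemma StronglyConvex.norm_sq_le {g : Eucl d → ℝ} (hs : StronglyConvex g τ)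
    {xs : Eucl d} (hm : IsMinOn g univ xs) (y : Eucl d) :
    τ / 2 * ‖y - xs‖ ^ 2 ≤ g y - g xs := by
  have h0 : gradient g xs = 0 := by
    have : fderiv ℝ g xs = 0 := (hm.isLocalMin Filter.univ_mem).fderiv_eq_zero
    simp [gradient, this]
  have := hs xs y
  rw [h0, inner_zero_left] at this
  linarith

end Objective

end

/-! ### Values and query counts of the programs -/

noncomputable section

namespace QueryProg

variable {ι X α β : Type} (f : ι → X → ℝ)

@[simp] lemma eval_pure (a : α) : (pure a : QueryProg ι X α).eval f = a := rfl

@[simp] lemma queries_pure (a : α) : (pure a : QueryProg ι X α).queries f = 0 := rfl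

@[simp] lemma eval_ask (i : ι) (x : X) : (ask i x).eval f = f i x := rfl

@[simp] lemma queries_ask (i : ι) (x : X) : (ask i x).queries f = 1 := rfl

@[simp] lemma eval_bind (q : QueryProg ι X α) (g : α → QueryProg ι X β) :
    (q >>= g).eval f = (g (q.eval f)).eval f := by
  change (q.bind g).eval f = _
  induction q with
  | done a => rfl
  | query i x k ih => exact ih (f i x)

@[simp] lemma queries_bind (q : QueryProg ι X α) (g : α → QueryProg ι X β) :
    (q >>= g).queries f = q.queries f + (g (q.eval f)).queries f := by
  change (q.bind g).queries f = _
  induction q with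
  | done a => simp [bind, queries, eval]
  | query i x k ih =>
    have := ih (f i x)
    simp only [bind, queries, eval] at this ⊢
    omega

@[simp] lemma eval_sum [AddCommMonoid α] (m : ℕ) (g : Fin m → QueryProg ι X α) :
    (sum m g).eval f = ∑ j, (g j).eval f := by
  induction m with
  | zero => simp [sum]
  | succ m ih => simp [sum, ih, Fin.sum_univ_castSucc]

@[simp] lemma queries_sum [AddCommMonoid α] (m : ℕ) (g : Fin m → QueryProg ι X α) :
    (sum m g).queries f = ∑ j, (g j).queries f := by
  induction m with
  | zero => simp [sum]
  | succ m ih => simp [sum, ih, Fin.sum_univ_castSucc]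

end QueryProg

variable {d n : ℕ} (f : Fin n → Eucl d → ℝ)

/-- The value of the Gaussian estimator. -/
def gaussEst (μ : ℝ) (x u : Eucl d) (i : Fin n) : Eucl d := ((f i (x + μ • u) - f i x) / μ) • u

/-- The value of the full coordinate-wise estimator. -/
def coordEst (ν : ℝ) (x : Eucl d) : Eucl d :=
  (1 / (n : ℝ)) • ∑ i, ∑ j, ((f i (x + ν • EuclideanSpace.single j (1 : ℝ)) -
    f i (x - ν • EuclideanSpace.single j (1 : ℝ))) / (2 * ν)) • EuclideanSpace.single j (1 : ℝ)

/-- The extrapolated point at which the stochastic gradient is taken. -/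
def lowPoint (τ α p γ : ℝ) (xt x xbar : Eucl d) : Eucl d :=
  (1 / (1 + τ * γ * (1 - α))) •
    (((1 + τ * γ) * (1 - α - p)) • xbar + α • x + ((1 + τ * γ) * p) • xt)

/-- The variance reduced gradient estimator at `xl` with pivot `xt`. -/
def gradEst (μ ν : ℝ) (xt xl u : Eucl d) (i : Fin n) : Eucl d :=
  gaussEst f μ xl u i - gaussEst f μ xt u i + coordEst f ν xt

/-- The new prox centre `x_t`. -/
def nextX (τ μ ν α p γ : ℝ) (xt x xbar u : Eucl d) (i : Fin n) : Eucl d :=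
  (1 / (1 + γ * τ)) • (x + (γ * τ) • lowPoint τ α p γ xt x xbar -
    γ • gradEst f μ ν xt (lowPoint τ α p γ xt x xbar) u i)

/-- The new averaged point `x̄_t`. -/
def nextBar (τ μ ν α p γ : ℝ) (xt x xbar u : Eucl d) (i : Fin n) : Eucl d :=
  (1 - α - p) • xbar + α • nextX f τ μ ν α p γ xt x xbar u i + p • xt

@[simp] lemma eval_pivotalGradient (ν : ℝ) (x : Eucl d) :
    (pivotalGradient ν x : Prog d n _).eval f = coordEst f ν x := by
  simp [pivotalGradient, coordEstimator, coordEst]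

lemma eval_innerStep (τ μ ν α p γ : ℝ) (xt x xbar u : Eucl d) (i : Fin n) :
    (innerStep τ μ α p γ xt (coordEst f ν xt) x xbar u i).eval f =
      (nextX f τ μ ν α p γ xt x xbar u i, nextBar f τ μ ν α p γ xt x xbar u i) := by
  simp [innerStep, gaussianEstimator, nextX, nextBar, gradEst, gaussEst, lowPoint]

/-- The state `(x_t, x̄_t, ∑_{r ≤ t} θ_r x̄_r)` after `t` inner iterations. -/
def loopState (τ μ ν α p γ : ℝ) (θ : ℕ → ℝ) (ξ : ℕ → Eucl d × Fin n) (x xt : Eucl d) :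
    ℕ → Eucl d × Eucl d × Eucl d
  | 0 => (x, xt, 0)
  | t + 1 =>
    let z := loopState τ μ ν α p γ θ ξ x xt t
    (nextX f τ μ ν α p γ xt z.1 z.2.1 (ξ (t + 1)).1 (ξ (t + 1)).2,
      nextBar f τ μ ν α p γ xt z.1 z.2.1 (ξ (t + 1)).1 (ξ (t + 1)).2,
      z.2.2 + θ (t + 1) • nextBar f τ μ ν α p γ xt z.1 z.2.1 (ξ (t + 1)).1 (ξ (t + 1)).2)

lemma eval_innerLoop (τ μ ν α p γ : ℝ) (θ : ℕ → ℝ) (ξ : ℕ → Eucl d × Fin n) (x xt : Eucl d)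
    (t : ℕ) :
    (innerLoop τ μ α p γ θ ξ xt (coordEst f ν xt) x t).eval f =
      loopState f τ μ ν α p γ θ ξ x xt t := by
  induction t with
  | zero => rfl
  | succ t ih => simp [innerLoop, ih, eval_innerStep, loopState]

/-- The pair `(x^s, x̃^s)` after `s` epochs. -/
def epochState (L τ μ ν : ℝ) (x0 : Eucl d) (ξ : ℕ → ℕ → Eucl d × Fin n) : ℕ → Eucl d × Eucl d
  | 0 => (x0, x0)
  | s + 1 =>
    let z := epochState L τ μ ν x0 ξ s
    let y := loopState f τ μ ν (alpha d n L τ (s + 1)) pWeight (gamma d n L τ (s + 1))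
      (theta d n L τ (s + 1)) (ξ (s + 1)) z.1 z.2 (epochLength d n (s + 1))
    (y.1, (1 / ∑ t ∈ Finset.Icc 1 (epochLength d n (s + 1)), theta d n L τ (s + 1) t) • y.2.2)

lemma eval_epochs (L τ μ ν : ℝ) (x0 : Eucl d) (ξ : ℕ → ℕ → Eucl d × Fin n) (S : ℕ) :
    (epochs L τ μ ν x0 ξ S).eval f = epochState f L τ μ ν x0 ξ S := by
  induction S with
  | zero => rfl
  | succ S ih => simp [epochs, epoch, ih, eval_innerLoop, epochState]

lemma eval_zoVarag (L τ μ ν : ℝ) (x0 : Eucl d) (ξ : ℕ → ℕ → Eucl d × Fin n) (S : ℕ) :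
    (zoVarag L τ μ ν x0 S ξ).eval f = (epochState f L τ μ ν x0 ξ S).2 := by
  simp [zoVarag, eval_epochs]

lemma queries_innerLoop (τ μ α p γ : ℝ) (θ : ℕ → ℝ) (ξ : ℕ → Eucl d × Fin n) (x xt gt : Eucl d)
    (t : ℕ) : (innerLoop τ μ α p γ θ ξ xt gt x t).queries f = 4 * t := by
  induction t with
  | zero => rfl
  | succ t ih => simp [innerLoop, innerStep, gaussianEstimator, ih]; ring

lemma queries_epoch (L τ μ ν : ℝ) (s : ℕ) (ξ : ℕ → Eucl d × Fin n) (x xt : Eucl d) :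
    (epoch L τ μ ν s ξ x xt).queries f = n * (d * 2) + 4 * epochLength d n s := by
  simp [epoch, pivotalGradient, coordEstimator, queries_innerLoop]

lemma epochLength_le (hd : 0 < d) (hn : 0 < n) (s : ℕ) : epochLength d n s ≤ (d + 4) * n := by
  have h : 2 ^ (s₀ d n - 1) ≤ (d + 4) * n := by
    simp only [s₀, Nat.add_sub_cancel]
    exact Nat.pow_log_le_self 2 (by positivity)
  unfold epochLength
  split_ifs with hs
  · exact (Nat.pow_le_pow_right (by norm_num) (by omega)).trans h
  · exact h

/-- The pivotal gradient costs `2dn` queries, an inner iteration costs four, and `T_s ≤ (d+4)n ≤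
5dn`; this gives `2 + 4·5 = 22`. -/
lemma queries_zoVarag_le (hd : 0 < d) (hn : 0 < n) (L τ μ ν : ℝ) (x0 : Eucl d)
    (ξ : ℕ → ℕ → Eucl d × Fin n) (S : ℕ) :
    (zoVarag L τ μ ν x0 S ξ).queries f ≤ 22 * (d * n) * S := by
  have h : (epochs L τ μ ν x0 ξ S).queries f ≤ 22 * (d * n) * S := by
    induction S with
    | zero => simp [epochs]
    | succ S ih =>
      have h1 := epochLength_le hd hn (S + 1)
      have h2 : n ≤ d * n := Nat.le_mul_of_pos_left n hd
      simp only [epochs, QueryProg.queries_bind, queries_epoch]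
      nlinarith
  simpa [zoVarag] using h

end

noncomputable section

/-! ### Gaussian moments -/

section Gaussian

/-- The moment is the fourth derivative at `0` of the moment generating function `exp (v t² / 2)`.
-/
lemma integral_pow_four_gaussianReal (v : NNReal) :
    ∫ x, x ^ 4 ∂(gaussianReal 0 v) = 3 * (v : ℝ) ^ 2 := by
  have h0 : (0 : ℝ) ∈ interior (integrableExpSet id (gaussianReal 0 v)) := by
    simp [integrableExpSet_id_gaussianReal]
  have h := iteratedDeriv_mgf_zero h0 4
  simp only [Pi.pow_apply, id_eq] at h
  rw [← h, mgf_id_gaussianReal]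
  -- Every derivative is a polynomial times the same exponential, so one rule for updating the
  -- polynomial handles all four.
  have hd : ∀ (q : ℝ → ℝ) (q' t : ℝ), HasDerivAt q q' t →
      HasDerivAt (fun t => q t * Real.exp (v * t ^ 2 / 2))
        ((q' + q t * (v * t)) * Real.exp (v * t ^ 2 / 2)) t := fun q q' t hq => by
    have h1 : HasDerivAt (fun t : ℝ => v * t ^ 2 / 2) (v * t) t := by
      refine ((((hasDerivAt_id t).pow 2).const_mul (v : ℝ)).div_const 2).congr_deriv ?_
      simp only [id_eq]; ring
    refine (hq.mul h1.exp).congr_deriv ?_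
    ring
  have e0 : (fun t : ℝ => Real.exp (0 * t + v * t ^ 2 / 2)) =
      fun t => (1 : ℝ) * Real.exp (v * t ^ 2 / 2) := by ext t; simp
  have e1 : deriv (fun t : ℝ => (1 : ℝ) * Real.exp (v * t ^ 2 / 2)) =
      fun t => (v * t) * Real.exp (v * t ^ 2 / 2) := by
    ext t
    rw [(hd (fun _ => 1) 0 t (hasDerivAt_const t 1)).deriv]; ring
  have e2 : deriv (fun t : ℝ => (v * t) * Real.exp (v * t ^ 2 / 2)) =
      fun t => (v + (v * t) ^ 2) * Real.exp (v * t ^ 2 / 2) := by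
    ext t
    rw [(hd (fun t => v * t) v t (by simpa using (hasDerivAt_id t).const_mul (v : ℝ))).deriv]; ring
  have e3 : deriv (fun t : ℝ => (v + (v * t) ^ 2) * Real.exp (v * t ^ 2 / 2)) =
      fun t => (3 * v ^ 2 * t + v ^ 3 * t ^ 3) * Real.exp (v * t ^ 2 / 2) := by
    ext t
    have : HasDerivAt (fun t : ℝ => v + (v * t) ^ 2) (2 * v ^ 2 * t) t := by
      refine ((((hasDerivAt_id t).const_mul (v : ℝ)).pow 2).const_add (v : ℝ)).congr_deriv ?_
      simp only [id_eq]; ring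
    rw [(hd _ _ t this).deriv]; ring
  have e4 : deriv (fun t : ℝ => (3 * v ^ 2 * t + v ^ 3 * t ^ 3) * Real.exp (v * t ^ 2 / 2)) 0 =
      3 * (v : ℝ) ^ 2 := by
    have : HasDerivAt (fun t : ℝ => 3 * (v : ℝ) ^ 2 * t + v ^ 3 * t ^ 3) (3 * (v : ℝ) ^ 2) 0 := by
      refine (((hasDerivAt_id (0 : ℝ)).const_mul (3 * (v : ℝ) ^ 2)).add
        (((hasDerivAt_id (0 : ℝ)).pow 3).const_mul ((v : ℝ) ^ 3))).congr_deriv ?_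
      simp
    rw [(hd _ _ 0 this).deriv]; simp
  rw [iteratedDeriv_succ, iteratedDeriv_succ, iteratedDeriv_succ, iteratedDeriv_succ,
    iteratedDeriv_zero, e0, e1, e2, e3, e4]

variable {E : Type*} [NormedAddCommGroup E] [InnerProductSpace ℝ E] [FiniteDimensional ℝ E]
  [MeasurableSpace E] [BorelSpace E]

lemma integrable_norm_pow_stdGaussian (k : ℕ) :
    Integrable (fun u : E => ‖u‖ ^ k) (stdGaussian E) := by
  rcases Nat.eq_zero_or_pos k with rfl | hk
  · simp
  · exact (IsGaussian.memLp_id (stdGaussian E) k (by simp)).integrable_norm_pow (by omega)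

/-- A continuous function of polynomial growth is integrable for the Gaussian measure. -/
lemma integrable_stdGaussian_of_le {F : Type*} [NormedAddCommGroup F] {g : E → F}
    (hg : AEStronglyMeasurable g (stdGaussian E)) (C : ℝ) (k : ℕ) (h : ∀ u, ‖g u‖ ≤ C * ‖u‖ ^ k) :
    Integrable g (stdGaussian E) :=
  ((integrable_norm_pow_stdGaussian k).const_mul C).mono' hg (Filter.Eventually.of_forall h)

lemma integral_inner_stdGaussian (a : E) : ∫ u, inner ℝ a u ∂(stdGaussian E) = 0 :=
  integral_strongDual_stdGaussian (innerSL ℝ a)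

lemma integral_inner_mul_inner_stdGaussian (a b : E) :
    ∫ u, inner ℝ a u * inner ℝ b u ∂(stdGaussian E) = inner ℝ a b := by
  have h := covarianceBilin_apply_eq_cov (μ := stdGaussian E) IsGaussian.memLp_two_id a b
  rw [covarianceBilin_stdGaussian, covariance, integral_inner_stdGaussian,
    integral_inner_stdGaussian] at h
  simp only [sub_zero] at h
  exact h.symm

lemma integral_inner_pow_four_stdGaussian (a : E) :
    ∫ u, (inner ℝ a u) ^ 4 ∂(stdGaussian E) = 3 * ‖a‖ ^ 4 := by
  have h := IsGaussian.map_eq_gaussianReal (μ := stdGaussian E) (innerSL ℝ a)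
  rw [integral_strongDual_stdGaussian, variance_dual_stdGaussian, innerSL_apply_norm] at h
  have h2 : ∫ x, x ^ 4 ∂((stdGaussian E).map (innerSL ℝ a)) =
      ∫ u, (inner ℝ a u) ^ 4 ∂(stdGaussian E) := by
    rw [integral_map (by fun_prop) (by fun_prop)]
    simp
  rw [← h2, h, integral_pow_four_gaussianReal, Real.coe_toNNReal _ (by positivity)]
  ring

lemma integrable_inner_mul_inner_stdGaussian (a b : E) :
    Integrable (fun u => inner ℝ a u * inner ℝ b u) (stdGaussian E) := by
  refine integrable_stdGaussian_of_le (by fun_prop) (‖a‖ * ‖b‖) 2 fun u => ?_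
  rw [norm_mul]
  have h1 := norm_inner_le_norm (𝕜 := ℝ) a u
  have h2 := norm_inner_le_norm (𝕜 := ℝ) b u
  calc _ ≤ (‖a‖ * ‖u‖) * (‖b‖ * ‖u‖) := by gcongr
    _ = _ := by ring

lemma integrable_inner_pow_four_stdGaussian (a : E) :
    Integrable (fun u => (inner ℝ a u) ^ 4) (stdGaussian E) := by
  refine integrable_stdGaussian_of_le (by fun_prop) (‖a‖ ^ 4) 4 fun u => ?_
  rw [norm_pow, ← mul_pow]
  gcongr
  exact norm_inner_le_norm (𝕜 := ℝ) a u

lemma integrable_inner_sq_mul_norm_sq_stdGaussian (a : E) :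
    Integrable (fun u => (inner ℝ a u) ^ 2 * ‖u‖ ^ 2) (stdGaussian E) := by
  refine integrable_stdGaussian_of_le (by fun_prop) (‖a‖ ^ 2) 4 fun u => ?_
  rw [norm_mul, norm_pow, norm_pow, norm_norm]
  calc _ ≤ (‖a‖ * ‖u‖) ^ 2 * ‖u‖ ^ 2 := by gcongr; exact norm_inner_le_norm (𝕜 := ℝ) a u
    _ = _ := by ring

/-- The exact value is `(d+2) ‖a‖²`. The cruder constant needs only fourth moments of single linear
forms, and the step size leaves room for it. -/
lemma integral_inner_sq_mul_norm_sq_stdGaussian_le (a : E) :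
    ∫ u, (inner ℝ a u) ^ 2 * ‖u‖ ^ 2 ∂(stdGaussian E) ≤ 3 * Module.finrank ℝ E * ‖a‖ ^ 2 := by
  rcases eq_or_ne a 0 with rfl | ha
  · simp
  have ha' : 0 < ‖a‖ := norm_pos_iff.2 ha
  set b := stdOrthonormalBasis ℝ E
  have hpt : ∀ u : E, (inner ℝ a u) ^ 2 * ‖u‖ ^ 2 ≤
      ∑ i, ((2 * ‖a‖ ^ 2)⁻¹ * (inner ℝ a u) ^ 4 + ‖a‖ ^ 2 / 2 * (inner ℝ (b i) u) ^ 4) := fun u => by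
    rw [← b.sum_sq_inner_right u, Finset.mul_sum]
    refine Finset.sum_le_sum fun i _ => ?_
    -- Weighted AM-GM, balanced so that both terms have expectation `3/2 ‖a‖²`.
    have h : (2 * ‖a‖ ^ 2)⁻¹ * (inner ℝ a u) ^ 4 + ‖a‖ ^ 2 / 2 * (inner ℝ (b i) u) ^ 4 -
        (inner ℝ a u) ^ 2 * (inner ℝ (b i) u) ^ 2 =
        (2 * ‖a‖ ^ 2)⁻¹ * ((inner ℝ a u) ^ 2 - ‖a‖ ^ 2 * (inner ℝ (b i) u) ^ 2) ^ 2 := by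
      field_simp; ring
    have h2 : 0 ≤ (2 * ‖a‖ ^ 2)⁻¹ * ((inner ℝ a u) ^ 2 - ‖a‖ ^ 2 * (inner ℝ (b i) u) ^ 2) ^ 2 := by
      positivity
    linarith
  have hint : ∀ i, Integrable (fun u => (2 * ‖a‖ ^ 2)⁻¹ * (inner ℝ a u) ^ 4 +
      ‖a‖ ^ 2 / 2 * (inner ℝ (b i) u) ^ 4) (stdGaussian E) := fun i =>
    ((integrable_inner_pow_four_stdGaussian a).const_mul _).add
      ((integrable_inner_pow_four_stdGaussian (b i)).const_mul _)
  refine (integral_mono (integrable_inner_sq_mul_norm_sq_stdGaussian a)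
    (integrable_finsetSum _ fun i _ => hint i) hpt).trans ?_
  rw [integral_finsetSum _ fun i _ => hint i]
  have hi : ∀ i, ∫ u, ((2 * ‖a‖ ^ 2)⁻¹ * (inner ℝ a u) ^ 4 +
      ‖a‖ ^ 2 / 2 * (inner ℝ (b i) u) ^ 4) ∂(stdGaussian E) = 3 * ‖a‖ ^ 2 := fun i => by
    rw [integral_add ((integrable_inner_pow_four_stdGaussian a).const_mul _)
      ((integrable_inner_pow_four_stdGaussian (b i)).const_mul _), integral_const_mul,
      integral_const_mul, integral_inner_pow_four_stdGaussian, integral_inner_pow_four_stdGaussian,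
      b.norm_eq_one]
    field_simp; ring
  simp only [hi, Finset.sum_const, Finset.card_univ, Fintype.card_fin, nsmul_eq_mul]
  apply le_of_eq; ring

end Gaussian

lemma integral_uniformOn {n : ℕ} (g : Fin n → ℝ) :
    ∫ i, g i ∂(uniformOn (univ : Set (Fin n))) = (1 / (n : ℝ)) * ∑ i, g i := by
  rw [integral_fintype (Integrable.of_finite)]
  rw [Finset.mul_sum]
  refine Finset.sum_congr rfl fun i _ => ?_
  simp [Measure.real, uniformOn_univ]

end

noncomputable section

/-! ### The deterministic accelerated proximal step -/

section ProxStep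

variable {E : Type*} [NormedAddCommGroup E] [InnerProductSpace ℝ E]

lemma norm_sq_convex_comb_le {s : ℝ} (hs : 0 ≤ s) (a b : E) :
    (1 + s) * ‖(1 / (1 + s)) • (a + s • b)‖ ^ 2 ≤ ‖a‖ ^ 2 + s * ‖b‖ ^ 2 := by
  have h1 : (0 : ℝ) < 1 + s := by positivity
  have e1 : ‖a + s • b‖ ^ 2 = ‖a‖ ^ 2 + 2 * (s * inner ℝ a b) + s ^ 2 * ‖b‖ ^ 2 := by
    rw [norm_add_sq_real, inner_smul_right, norm_smul, mul_pow, Real.norm_eq_abs, sq_abs]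
  have e2 : ‖a - b‖ ^ 2 = ‖a‖ ^ 2 - 2 * inner ℝ a b + ‖b‖ ^ 2 := norm_sub_sq_real a b
  rw [norm_smul, mul_pow, Real.norm_of_nonneg (by positivity), e1]
  have h2 : (1 + s) * ((1 / (1 + s)) ^ 2 * (‖a‖ ^ 2 + 2 * (s * inner ℝ a b) + s ^ 2 * ‖b‖ ^ 2)) =
      ‖a‖ ^ 2 + s * ‖b‖ ^ 2 - s / (1 + s) * ‖a - b‖ ^ 2 := by
    rw [e2]; field_simp; ring
  rw [h2]
  have : 0 ≤ s / (1 + s) * ‖a - b‖ ^ 2 := by positivity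
  linarith

/-- One accelerated proximal step with the inexact gradient `gx + m + w` at `xl`, where `m` is the
part of the error that averages out. -/
lemma prox_step {fn : E → ℝ} {L τ α p γ A : ℝ} (hτ : 0 < τ) (hα : 0 < α)
    (hαp : 0 ≤ 1 - α - p) (hα1 : α ≤ 1) (hγ : 0 < γ) (hA : 0 < A)
    (hAL : A + L * α ^ 2 ≤ α / γ * (1 + τ * γ))
    {x xbar xt xl y gx m w x' xbar' : E}
    (hxl : xl = (1 / (1 + τ * γ * (1 - α))) •
      (((1 + τ * γ) * (1 - α - p)) • xbar + α • x + ((1 + τ * γ) * p) • xt))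
    (hx' : x' = (1 / (1 + γ * τ)) • (x + (γ * τ) • xl - γ • (gx + m + w)))
    (hxbar' : xbar' = (1 - α - p) • xbar + α • x' + p • xt)
    (hsm : fn xbar' - fn xl - inner ℝ gx (xbar' - xl) ≤ L / 2 * ‖xbar' - xl‖ ^ 2)
    (hconv : fn xl + inner ℝ gx (xbar - xl) ≤ fn xbar)
    (hsc : fn xl + inner ℝ gx (y - xl) + τ / 2 * ‖y - xl‖ ^ 2 ≤ fn y) :
    fn xbar' + α / γ * ((1 + τ * γ / 2) / 2 * ‖x' - y‖ ^ 2) ≤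
      (1 - α - p) * fn xbar + α * fn y + p * (fn xl + inner ℝ gx (xt - xl)) +
      α / γ * (‖x - y‖ ^ 2 / 2) + α ^ 2 / (2 * A) * ‖m‖ ^ 2 + α / τ * ‖w‖ ^ 2 -
      α * inner ℝ m ((1 / (1 + γ * τ)) • (x + (γ * τ) • xl) - y) := by
  set c : E := (1 / (1 + γ * τ)) • (x + (γ * τ) • xl) with hc
  set v : E := x' - c with hv
  have hq : (0 : ℝ) < 1 + γ * τ := by positivity
  have hq2 : (0 : ℝ) < 1 + τ * γ * (1 - α) := by
    have : 0 ≤ τ * γ * (1 - α) := mul_nonneg (by positivity) (by linarith)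
    linarith
  have hG : gx + m + w = -(((1 + γ * τ) / γ) • v) := by
    have : v = -((1 / (1 + γ * τ)) • γ • (gx + m + w)) := by
      rw [hv, hx', hc, smul_sub]; abel
    rw [this, smul_neg, neg_neg, smul_smul, smul_smul]
    rw [show (1 + γ * τ) / γ * (1 / (1 + γ * τ)) * γ = 1 by field_simp, one_smul]
  -- This identity dictates the coefficients of `x̲_t`: the averaged point differs from it only by
  -- the effect `v` of the gradient on the prox step, `c` being the prox point for zero gradient.
  have hbar : xbar' - xl = α • v := by
    have h1 : (1 + τ * γ * (1 - α)) • xl =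
        ((1 + τ * γ) * (1 - α - p)) • xbar + α • x + ((1 + τ * γ) * p) • xt := by
      rw [hxl, smul_smul, mul_one_div_cancel hq2.ne', one_smul]
    have h2 : (1 + γ * τ) • c = x + (γ * τ) • xl := by
      rw [hc, smul_smul, mul_one_div_cancel hq.ne', one_smul]
    have h3 : (1 + γ * τ) • (xbar' - xl - α • v) = 0 := by
      have : (1 + γ * τ) • (xbar' - xl - α • v) =
          (((1 + τ * γ) * (1 - α - p)) • xbar + α • x + ((1 + τ * γ) * p) • xt)
          - (1 + τ * γ * (1 - α)) • xl + α • ((1 + γ * τ) • c - (x + (γ * τ) • xl)) := by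
        rw [hxbar', hv]; module
      rw [this, h1, h2]; simp
    have := (smul_eq_zero.1 h3).resolve_left hq.ne'
    exact sub_eq_zero.1 this
  -- Three-point inequality for the prox step: the optimality condition `hG` turns the inner product
  -- into squared distances, and convexity of the squared norm removes `c`.
  have hprox : α * inner ℝ (gx + m + w) (x' - y) ≤
      -(α / γ * (1 + τ * γ) / 2 * ‖v‖ ^ 2) - α / γ * (1 + τ * γ) / 2 * ‖x' - y‖ ^ 2
      + α / γ / 2 * ‖x - y‖ ^ 2 + α * τ / 2 * ‖y - xl‖ ^ 2 := by
    have h1 : ‖c - y‖ ^ 2 = ‖x' - y‖ ^ 2 - 2 * inner ℝ v (x' - y) + ‖v‖ ^ 2 := by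
      have : c - y = (x' - y) - v := by rw [hv]; abel
      rw [this, norm_sub_sq_real, real_inner_comm]
    have h2 : (1 + γ * τ) * ‖c - y‖ ^ 2 ≤ ‖x - y‖ ^ 2 + γ * τ * ‖y - xl‖ ^ 2 := by
      have h3 := norm_sq_convex_comb_le (s := γ * τ) (by positivity) (x - y) (xl - y)
      have h4 : (1 / (1 + γ * τ)) • (x - y + (γ * τ) • (xl - y)) = c - y := by
        have : x - y + (γ * τ) • (xl - y) = x + (γ * τ) • xl - (1 + γ * τ) • y := by module
        rw [this, smul_sub, smul_smul, one_div_mul_cancel hq.ne', one_smul]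
      rw [h4, norm_sub_rev xl y] at h3
      exact h3
    rw [hG, inner_neg_left, real_inner_smul_left]
    have h5 : inner ℝ v (x' - y) = (‖x' - y‖ ^ 2 + ‖v‖ ^ 2 - ‖c - y‖ ^ 2) / 2 := by linarith
    rw [h5]
    have h6 : α * -((1 + γ * τ) / γ * ((‖x' - y‖ ^ 2 + ‖v‖ ^ 2 - ‖c - y‖ ^ 2) / 2)) =
        -(α / γ * (1 + τ * γ) / 2 * ‖v‖ ^ 2) - α / γ * (1 + τ * γ) / 2 * ‖x' - y‖ ^ 2 +
        α / γ / 2 * ((1 + γ * τ) * ‖c - y‖ ^ 2) := by field_simp; ring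
    rw [h6]
    have h7 : α / γ / 2 * ((1 + γ * τ) * ‖c - y‖ ^ 2) ≤
        α / γ / 2 * (‖x - y‖ ^ 2 + γ * τ * ‖y - xl‖ ^ 2) :=
      mul_le_mul_of_nonneg_left h2 (by positivity)
    have h8 : α / γ / 2 * (‖x - y‖ ^ 2 + γ * τ * ‖y - xl‖ ^ 2) =
      α / γ / 2 * ‖x - y‖ ^ 2 + α * τ / 2 * ‖y - xl‖ ^ 2 := by field_simp
    linarith
  -- Young's inequality with parameter `A`, the share of the `‖v‖²` term not needed for smoothness.
  have hm : -(α * inner ℝ m v) ≤ A / 2 * ‖v‖ ^ 2 + α ^ 2 / (2 * A) * ‖m‖ ^ 2 := by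
    have h1 := (abs_le.1 (abs_real_inner_le_norm m v)).1
    have h2 : A / 2 * ‖v‖ ^ 2 + α ^ 2 / (2 * A) * ‖m‖ ^ 2 - α * (‖m‖ * ‖v‖) =
        1 / (2 * A) * (A * ‖v‖ - α * ‖m‖) ^ 2 := by field_simp; ring
    have h3 : 0 ≤ 1 / (2 * A) * (A * ‖v‖ - α * ‖m‖) ^ 2 := by positivity
    have h4 := mul_le_mul_of_nonneg_left h1 hα.le
    linarith
  -- Young's inequality spends half of the strong convexity gain on the bias, hence `1 + τγ/2` and
  -- not `1 + τγ` in the conclusion.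
  have hw : -(α * inner ℝ w (x' - y)) ≤ α / τ * ‖w‖ ^ 2 + α * τ / 4 * ‖x' - y‖ ^ 2 := by
    have h1 := (abs_le.1 (abs_real_inner_le_norm w (x' - y))).1
    have h2 : α / τ * ‖w‖ ^ 2 + α * τ / 4 * ‖x' - y‖ ^ 2 - α * (‖w‖ * ‖x' - y‖) =
        α / τ * (‖w‖ - τ / 2 * ‖x' - y‖) ^ 2 := by field_simp; ring
    have h3 : 0 ≤ α / τ * (‖w‖ - τ / 2 * ‖x' - y‖) ^ 2 := by positivity
    have h4 := mul_le_mul_of_nonneg_left h1 hα.le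
    linarith
  have e1 : inner ℝ gx (xbar' - xl) = (1 - α - p) * inner ℝ gx (xbar - xl) +
      α * inner ℝ gx (y - xl) + α * inner ℝ gx (x' - y) + p * inner ℝ gx (xt - xl) := by
    simp only [← real_inner_smul_right, ← inner_add_right]
    congr 1
    rw [hxbar']; module
  -- The point `x'` depends on the noise but `c` does not, so `⟨m, c - y⟩` has mean zero and only
  -- `⟨m, v⟩` has to be estimated.
  have e2 : inner ℝ (gx + m + w) (x' - y) = inner ℝ gx (x' - y) + inner ℝ m v +
      inner ℝ m (c - y) + inner ℝ w (x' - y) := by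
    rw [inner_add_left, inner_add_left, add_assoc (inner ℝ gx (x' - y)) (inner ℝ m v),
      ← inner_add_right, show v + (c - y) = x' - y by rw [hv]; abel]
  have e3 : ‖xbar' - xl‖ ^ 2 = α ^ 2 * ‖v‖ ^ 2 := by
    rw [hbar, norm_smul, mul_pow, Real.norm_eq_abs, sq_abs]
  rw [e1, e3] at hsm
  have h9 := mul_le_mul_of_nonneg_left hconv hαp
  have h10 := mul_le_mul_of_nonneg_left hsc hα.le
  have h11 := mul_le_mul_of_nonneg_right hAL (by positivity : 0 ≤ ‖v‖ ^ 2 / 2)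
  have h12 : α / γ * ((1 + τ * γ / 2) / 2 * ‖x' - y‖ ^ 2) =
      α / γ * (1 + τ * γ) / 2 * ‖x' - y‖ ^ 2 - α * τ / 4 * ‖x' - y‖ ^ 2 := by
    field_simp; ring
  rw [e2] at hprox
  rw [h12]
  linarith

end ProxStep

/-! ### Finite difference errors of the estimators -/

section Estimators

variable {d n : ℕ} {f : Fin n → Eucl d → ℝ} {L τ μ ν : ℝ}

/-- The Taylor remainder `L/2 (μ‖u‖)²` is divided by `μ` and multiplied by the direction `u`. -/
lemma SmoothConvex.norm_gaussEst_sub_le (hf : SmoothConvex f L) (hμ : 0 < μ) (x u : Eucl d)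
    (i : Fin n) :
    ‖gaussEst f μ x u i - (inner ℝ (gradient (f i) x) u : ℝ) • u‖ ≤ μ * L / 2 * ‖u‖ ^ 3 := by
  have h := abs_sub_sub_inner_gradient_le (hf.differentiable i) (hf.smooth i) x (x + μ • u)
  rw [add_sub_cancel_left, real_inner_smul_right, norm_smul, Real.norm_of_nonneg hμ.le] at h
  rw [gaussEst, ← sub_smul, norm_smul, Real.norm_eq_abs]
  have e : (f i (x + μ • u) - f i x) / μ - inner ℝ (gradient (f i) x) u =
      (f i (x + μ • u) - f i x - μ * inner ℝ (gradient (f i) x) u) / μ := by field_simp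
  rw [e, abs_div, abs_of_pos hμ]
  calc _ ≤ (L / 2 * (μ * ‖u‖) ^ 2) / μ * ‖u‖ := by gcongr
    _ = _ := by field_simp

/-- Two Taylor remainders of size `L ν²/2`, divided by `2ν`, give `L ν/2` per coordinate; the
triangle inequality over the coordinates contributes the factor `d`. -/
lemma SmoothConvex.norm_coordEst_sub_le (hf : SmoothConvex f L) (hn : 0 < n) (hν : 0 < ν)
    (x : Eucl d) : ‖coordEst f ν x - gradient (objective f) x‖ ≤ d * L * ν / 2 := by
  have hn' : (0 : ℝ) < n := by exact_mod_cast hn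
  have hi : ∀ i, ‖(∑ j, ((f i (x + ν • EuclideanSpace.single j (1 : ℝ)) -
      f i (x - ν • EuclideanSpace.single j (1 : ℝ))) / (2 * ν)) • EuclideanSpace.single j (1 : ℝ))
      - gradient (f i) x‖ ≤ d * L * ν / 2 := fun i => by
    have hg : ∀ g : Eucl d, ∑ j, (inner ℝ g
        (EuclideanSpace.single j (1 : ℝ)) : ℝ) • EuclideanSpace.single j (1 : ℝ) = g := fun g => by
      conv_rhs => rw [← (EuclideanSpace.basisFun (Fin d) ℝ).sum_repr g]
      simp [EuclideanSpace.inner_single_right]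
    conv_lhs => rw [← hg (gradient (f i) x)]
    rw [← Finset.sum_sub_distrib]
    have hj : ∀ j ∈ Finset.univ, ‖((f i (x + ν • EuclideanSpace.single j (1 : ℝ)) -
        f i (x - ν • EuclideanSpace.single j (1 : ℝ))) / (2 * ν)) • EuclideanSpace.single j (1 : ℝ)
        - (inner ℝ (gradient (f i) x) (EuclideanSpace.single j (1 : ℝ)) : ℝ) •
          EuclideanSpace.single j (1 : ℝ)‖ ≤ L * ν / 2 := fun j _ => by
      set e : Eucl d := EuclideanSpace.single j (1 : ℝ) with he
      have hne : ‖e‖ = 1 := by simp [he]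
      have h1 := abs_sub_sub_inner_gradient_le (hf.differentiable i) (hf.smooth i) x (x + ν • e)
      have h2 := abs_sub_sub_inner_gradient_le (hf.differentiable i) (hf.smooth i) x (x - ν • e)
      rw [add_sub_cancel_left, real_inner_smul_right, norm_smul, Real.norm_of_nonneg hν.le, hne]
        at h1
      rw [sub_sub_cancel_left, inner_neg_right, real_inner_smul_right, norm_neg, norm_smul,
        Real.norm_of_nonneg hν.le, hne] at h2
      rw [← sub_smul, norm_smul, hne, mul_one, Real.norm_eq_abs]
      have e1 : (f i (x + ν • e) - f i (x - ν • e)) / (2 * ν) - inner ℝ (gradient (f i) x) e =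
          ((f i (x + ν • e) - f i x - ν * inner ℝ (gradient (f i) x) e) -
          (f i (x - ν • e) - f i x - -(ν * inner ℝ (gradient (f i) x) e))) / (2 * ν) := by
        field_simp; ring
      rw [e1, abs_div, abs_of_pos (by positivity : 0 < 2 * ν), div_le_iff₀ (by positivity)]
      refine (abs_sub _ _).trans ?_
      nlinarith
    refine (norm_sum_le_of_le _ hj).trans (le_of_eq ?_)
    simp; ring
  rw [hf.gradient_objective, coordEst, ← smul_sub, ← Finset.sum_sub_distrib, norm_smul,
    Real.norm_of_nonneg (by positivity), one_div, inv_mul_le_iff₀ hn']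
  refine (norm_sum_le_of_le _ fun i _ => hi i).trans (le_of_eq ?_)
  simp

/-- The centred part of the error of the variance reduced estimator. -/
def noise (f : Fin n → Eucl d → ℝ) (xl xt : Eucl d) (w : Eucl d × Fin n) : Eucl d :=
  (inner ℝ (gradient (f w.2) xl - gradient (f w.2) xt) w.1 : ℝ) • w.1 -
    (gradient (objective f) xl - gradient (objective f) xt)

/-- What remains after removing the gradient and the centred noise is two Gaussian remainders and
one coordinate remainder. The bound is uniform in `f` and in the points, which is why the thresholds
can be. -/
lemma SmoothConvex.norm_gradEst_sub_le (hf : SmoothConvex f L) (hn : 0 < n) (hμ : 0 < μ)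
    (hν : 0 < ν) (xt xl : Eucl d) (w : Eucl d × Fin n) :
    ‖gradEst f μ ν xt xl w.1 w.2 - gradient (objective f) xl - noise f xl xt w‖ ^ 2 ≤
      2 * (μ * L) ^ 2 * ‖w.1‖ ^ 6 + (d * L * ν) ^ 2 / 2 := by
  have h1 := hf.norm_gaussEst_sub_le hμ xl w.1 w.2
  have h2 := hf.norm_gaussEst_sub_le hμ xt w.1 w.2
  have h3 := hf.norm_coordEst_sub_le hn hν xt
  have e : gradEst f μ ν xt xl w.1 w.2 - gradient (objective f) xl - noise f xl xt w =
      (gaussEst f μ xl w.1 w.2 - (inner ℝ (gradient (f w.2) xl) w.1 : ℝ) • w.1) -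
      (gaussEst f μ xt w.1 w.2 - (inner ℝ (gradient (f w.2) xt) w.1 : ℝ) • w.1) +
      (coordEst f ν xt - gradient (objective f) xt) := by
    rw [gradEst, noise, inner_sub_left, sub_smul]; abel
  rw [e]
  have h4 : ‖(gaussEst f μ xl w.1 w.2 - (inner ℝ (gradient (f w.2) xl) w.1 : ℝ) • w.1) -
      (gaussEst f μ xt w.1 w.2 - (inner ℝ (gradient (f w.2) xt) w.1 : ℝ) • w.1) +
      (coordEst f ν xt - gradient (objective f) xt)‖ ≤ μ * L * ‖w.1‖ ^ 3 + d * L * ν / 2 := by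
    refine (norm_add_le _ _).trans ?_
    have := norm_sub_le (gaussEst f μ xl w.1 w.2 - (inner ℝ (gradient (f w.2) xl) w.1 : ℝ) • w.1)
      (gaussEst f μ xt w.1 w.2 - (inner ℝ (gradient (f w.2) xt) w.1 : ℝ) • w.1)
    linarith
  calc _ ≤ (μ * L * ‖w.1‖ ^ 3 + d * L * ν / 2) ^ 2 := by gcongr
    _ ≤ _ := by nlinarith [sq_nonneg (μ * L * ‖w.1‖ ^ 3 - d * L * ν / 2)]

end Estimators

/-! ### Moments of the centred noise under the law of one sample -/

section Sampling

variable {d n : ℕ}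

/-- The law of one sample `(u, i)`. -/
def sampleLaw (d n : ℕ) : Measure (Eucl d × Fin n) :=
  (stdGaussian (Eucl d)).prod (uniformOn (univ : Set (Fin n)))

instance : IsFiniteMeasure (sampleLaw d n) := by unfold sampleLaw; infer_instance

lemma integral_sampleLaw {g : Eucl d × Fin n → ℝ} (hg : ∀ i, Measurable fun u => g (u, i))
    (hi : ∀ i, Integrable (fun u => g (u, i)) (stdGaussian (Eucl d))) :
    Integrable g (sampleLaw d n) ∧
      ∫ w, g w ∂(sampleLaw d n) = (1 / (n : ℝ)) * ∑ i, ∫ u, g (u, i) ∂(stdGaussian (Eucl d)) := by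
  have h1 : Integrable g (sampleLaw d n) := by
    refine (integrable_prod_iff' (measurable_from_prod_countable_left hg).aestronglyMeasurable).2
      ⟨Filter.Eventually.of_forall hi, Integrable.of_finite⟩
  refine ⟨h1, ?_⟩
  unfold sampleLaw at h1 ⊢
  rw [integral_prod_symm _ h1, integral_uniformOn]

end Sampling

end

noncomputable section

variable {d n : ℕ} {f : Fin n → Eucl d → ℝ} {L τ μ ν : ℝ}

lemma isProbabilityMeasure_sampleLaw (hn : 0 < n) : IsProbabilityMeasure (sampleLaw d n) := by
  have : Nonempty (Fin n) := ⟨⟨0, hn⟩⟩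
  unfold sampleLaw
  infer_instance

lemma SmoothConvex.average_inner_gradient_sub (hf : SmoothConvex f L) (x y z : Eucl d) :
    (1 / (n : ℝ)) * ∑ i, (inner ℝ (gradient (f i) x - gradient (f i) y) z : ℝ) =
      inner ℝ (gradient (objective f) x - gradient (objective f) y) z := by
  rw [hf.gradient_objective, hf.gradient_objective, ← smul_sub, ← Finset.sum_sub_distrib,
    real_inner_smul_left, sum_inner]

/-- Cocoercivity of each component, averaged: the Bregman divergences of the `f_i` add up to that of
`f`. This is what variance reduction rests on. -/
lemma SmoothConvex.average_norm_gradient_sub_sq_le (hf : SmoothConvex f L) (hL : 0 < L)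
    (x y : Eucl d) :
    (1 / (n : ℝ)) * ∑ i, ‖gradient (f i) x - gradient (f i) y‖ ^ 2 ≤
      2 * L * (objective f y - objective f x - inner ℝ (gradient (objective f) x) (y - x)) := by
  have h : ∑ i, ‖gradient (f i) x - gradient (f i) y‖ ^ 2 ≤
      ∑ i, 2 * L * (f i y - f i x - inner ℝ (gradient (f i) x) (y - x)) :=
    Finset.sum_le_sum fun i _ =>
      norm_gradient_sub_sq_le hL (hf.convex i) (hf.differentiable i) (hf.smooth i) x y
  refine (mul_le_mul_of_nonneg_left h (by positivity)).trans (le_of_eq ?_)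
  rw [hf.gradient_objective, real_inner_smul_left, sum_inner, ← Finset.mul_sum,
    Finset.sum_sub_distrib, Finset.sum_sub_distrib, objective, objective]
  ring

lemma noise_apply_sq (xl xt u : Eucl d) (i : Fin n) :
    ‖noise f xl xt (u, i)‖ ^ 2 =
      (inner ℝ (gradient (f i) xl - gradient (f i) xt) u) ^ 2 * ‖u‖ ^ 2 -
      2 * (inner ℝ (gradient (f i) xl - gradient (f i) xt) u *
        inner ℝ (gradient (objective f) xl - gradient (objective f) xt) u) +
      ‖gradient (objective f) xl - gradient (objective f) xt‖ ^ 2 := by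
  rw [noise, norm_sub_sq_real, norm_smul, mul_pow, Real.norm_eq_abs, sq_abs, real_inner_smul_left,
    real_inner_comm u (gradient (objective f) xl - gradient (objective f) xt)]

/-- Centring contributes `-2‖a‖² + ‖a‖² ≤ 0` and is dropped; the uncentred part is `3d` times the
average squared gradient difference, which cocoercivity turns into a Bregman divergence. -/
lemma SmoothConvex.integral_norm_noise_sq_le (hf : SmoothConvex f L) (hL : 0 < L)
    (xl xt : Eucl d) :
    Integrable (fun w => ‖noise f xl xt w‖ ^ 2) (sampleLaw d n) ∧
      ∫ w, ‖noise f xl xt w‖ ^ 2 ∂(sampleLaw d n) ≤ 6 * d * L *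
        (objective f xt - objective f xl - inner ℝ (gradient (objective f) xl) (xt - xl)) := by
  set a : Eucl d := gradient (objective f) xl - gradient (objective f) xt with ha
  have h1 : ∀ i, Integrable (fun u : Eucl d => (inner ℝ (gradient (f i) xl - gradient (f i) xt) u) ^ 2
      * ‖u‖ ^ 2) (stdGaussian (Eucl d)) := fun i => integrable_inner_sq_mul_norm_sq_stdGaussian _
  have h2 : ∀ i, Integrable (fun u : Eucl d => 2 * (inner ℝ (gradient (f i) xl - gradient (f i) xt) u *
        inner ℝ a u)) (stdGaussian (Eucl d)) := fun i =>
    (integrable_inner_mul_inner_stdGaussian _ _).const_mul 2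
  have key := integral_sampleLaw (g := fun w => ‖noise f xl xt w‖ ^ 2) (d := d) (n := n)
    (fun i => by simp only [noise]; fun_prop) (fun i => by
      simp only [noise_apply_sq]
      exact ((h1 i).sub (h2 i)).add (integrable_const _))
  refine ⟨key.1, ?_⟩
  rw [key.2]
  have h3 : ∀ i, ∫ u, ‖noise f xl xt (u, i)‖ ^ 2 ∂(stdGaussian (Eucl d)) ≤
      3 * d * ‖gradient (f i) xl - gradient (f i) xt‖ ^ 2 -
        2 * inner ℝ (gradient (f i) xl - gradient (f i) xt) a + ‖a‖ ^ 2 := fun i => by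
    have h12 : Integrable (fun u : Eucl d =>
        (inner ℝ (gradient (f i) xl - gradient (f i) xt) u) ^ 2 * ‖u‖ ^ 2 -
        2 * (inner ℝ (gradient (f i) xl - gradient (f i) xt) u * inner ℝ a u))
        (stdGaussian (Eucl d)) := (h1 i).sub (h2 i)
    simp only [noise_apply_sq, ← ha]
    rw [integral_add h12 (integrable_const _), integral_sub (h1 i) (h2 i),
      integral_const_mul, integral_inner_mul_inner_stdGaussian]
    have := integral_inner_sq_mul_norm_sq_stdGaussian_le (gradient (f i) xl - gradient (f i) xt)
    rw [finrank_euclideanSpace_fin] at this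
    simp only [integral_const, probReal_univ, one_smul]
    linarith
  have h4 := hf.average_norm_gradient_sub_sq_le hL xl xt
  have h5 := hf.average_inner_gradient_sub xl xt a
  rw [← ha, real_inner_self_eq_norm_sq] at h5
  have h6 : (1 / (n : ℝ)) * ∑ i, ∫ u, ‖noise f xl xt (u, i)‖ ^ 2 ∂(stdGaussian (Eucl d)) ≤
      3 * d * ((1 / (n : ℝ)) * ∑ i, ‖gradient (f i) xl - gradient (f i) xt‖ ^ 2) -
      2 * ((1 / (n : ℝ)) * ∑ i, (inner ℝ (gradient (f i) xl - gradient (f i) xt) a : ℝ)) +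
      (1 / (n : ℝ)) * n * ‖a‖ ^ 2 := by
    refine (mul_le_mul_of_nonneg_left (Finset.sum_le_sum fun i _ => h3 i)
      (by positivity)).trans (le_of_eq ?_)
    rw [Finset.sum_add_distrib, Finset.sum_sub_distrib, ← Finset.mul_sum, ← Finset.mul_sum]
    simp only [Finset.sum_const, Finset.card_univ, Fintype.card_fin, nsmul_eq_mul]
    ring
  -- An inequality and not an equality, so that `n = 0` with `1 / 0 = 0` is included.
  have h7 : (1 / (n : ℝ)) * n ≤ 1 := by
    rw [one_div]; exact inv_mul_le_one
  have h8 := mul_le_mul_of_nonneg_right h7 (sq_nonneg ‖a‖)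
  have h9 := mul_le_mul_of_nonneg_left h4 (by positivity : (0 : ℝ) ≤ 3 * d)
  have h10 : 0 ≤ ‖a‖ ^ 2 := by positivity
  rw [h5] at h6
  linarith

/-- Isotropy of `u` gives `E ⟨a, u⟩⟨z, u⟩ = ⟨a, z⟩`, and averaging over the components yields the
gradient of `f`. -/
lemma SmoothConvex.integral_inner_noise (hf : SmoothConvex f L) (hn : 0 < n)
    (xl xt z : Eucl d) :
    Integrable (fun w => (inner ℝ (noise f xl xt w) z : ℝ)) (sampleLaw d n) ∧
      ∫ w, inner ℝ (noise f xl xt w) z ∂(sampleLaw d n) = 0 := by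
  set a : Eucl d := gradient (objective f) xl - gradient (objective f) xt with ha
  have e : ∀ (u : Eucl d) (i : Fin n), (inner ℝ (noise f xl xt (u, i)) z : ℝ) =
      inner ℝ (gradient (f i) xl - gradient (f i) xt) u * inner ℝ z u - inner ℝ a z := fun u i => by
    rw [noise, inner_sub_left, real_inner_smul_left, real_inner_comm z u]
  have h1 : ∀ i, Integrable (fun u : Eucl d => (inner ℝ (gradient (f i) xl - gradient (f i) xt) u *
        inner ℝ z u)) (stdGaussian (Eucl d)) := fun i =>
    integrable_inner_mul_inner_stdGaussian _ _
  have key := integral_sampleLaw (g := fun w => inner ℝ (noise f xl xt w) z) (d := d) (n := n)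
    (fun i => by simp only [noise]; fun_prop) (fun i => by
      simp only [e]
      exact (h1 i).sub (integrable_const _))
  refine ⟨key.1, ?_⟩
  rw [key.2]
  have h2 : ∀ i, ∫ u, inner ℝ (noise f xl xt (u, i)) z ∂(stdGaussian (Eucl d)) =
      inner ℝ (gradient (f i) xl - gradient (f i) xt) z - inner ℝ a z := fun i => by
    simp only [e]
    rw [integral_sub (h1 i) (integrable_const _), integral_inner_mul_inner_stdGaussian]
    simp
  simp only [h2, Finset.sum_sub_distrib, mul_sub]
  rw [hf.average_inner_gradient_sub, ← ha]
  have hn' : (n : ℝ) ≠ 0 := by exact_mod_cast hn.ne'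
  simp [hn']

/-- The error level caused by the finite differences. -/
def errLevel (d : ℕ) (L τ μ ν : ℝ) : ℝ :=
  (2 * (μ * L) ^ 2 * (∫ u, ‖u‖ ^ 6 ∂(stdGaussian (Eucl d))) + (d * L * ν) ^ 2 / 2) / τ

lemma errLevel_nonneg (hτ : 0 < τ) : 0 ≤ errLevel d L τ μ ν := by
  have : 0 ≤ ∫ u, ‖u‖ ^ 6 ∂(stdGaussian (Eucl d)) := integral_nonneg fun u => by positivity
  unfold errLevel
  positivity

/-- The assumptions on the problem and on the smoothing parameters, with a minimiser `y`. -/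
structure Setting (f : Fin n → Eucl d → ℝ) (L τ μ ν : ℝ) (y : Eucl d) : Prop where
  n_pos : 0 < n
  L_pos : 0 < L
  τ_pos : 0 < τ
  μ_pos : 0 < μ
  ν_pos : 0 < ν
  smooth : SmoothConvex f L
  strong : StronglyConvex (objective f) τ
  isMin : IsMinOn (objective f) univ y

lemma Setting.gap_nonneg {y : Eucl d} (h : Setting f L τ μ ν y) (x : Eucl d) :
    0 ≤ objective f x - objective f y := sub_nonneg.2 (h.isMin (mem_univ x))

/-- Expected progress of one inner iteration. -/
lemma Setting.lintegral_step_le {y : Eucl d} (h : Setting f L τ μ ν y) {α γ : ℝ} (hα : 0 < α)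
    (hα2 : α ≤ 1 / 2) (hγ : γ = 1 / (12 * (d + 4) * L * α)) (xt x xbar : Eucl d) :
    ∫⁻ w, ENNReal.ofReal (objective f (nextBar f τ μ ν α pWeight γ xt x xbar w.1 w.2)
        - objective f y + α / γ * ((1 + τ * γ / 2) / 2 *
          ‖nextX f τ μ ν α pWeight γ xt x xbar w.1 w.2 - y‖ ^ 2)) ∂(sampleLaw d n) ≤
      ENNReal.ofReal ((1 - α - pWeight) * (objective f xbar - objective f y) +
        pWeight * (objective f xt - objective f y) + α / γ * (‖x - y‖ ^ 2 / 2) +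
        α * errLevel d L τ μ ν) := by
  have hL := h.L_pos
  have hτ := h.τ_pos
  have hγ0 : 0 < γ := by rw [hγ]; positivity
  have hp : pWeight = 1 / 2 := rfl
  have := isProbabilityMeasure_sampleLaw (d := d) h.n_pos
  set xl := lowPoint τ α pWeight γ xt x xbar with hxl
  -- Since `α/γ = 12(d+4) L α²`, this is what is left of `α/γ` after the smoothness term `L α²`.
  set A : ℝ := (12 * d + 47) * L * α ^ 2 with hA
  have hA0 : 0 < A := by positivity
  set z : Eucl d := (1 / (1 + γ * τ)) • (x + (γ * τ) • xl) - y with hz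
  set gx := gradient (objective f) xl with hgx
  set B := objective f xt - objective f xl - inner ℝ gx (xt - xl) with hB
  set M := ∫ u, ‖u‖ ^ 6 ∂(stdGaussian (Eucl d)) with hM
  set K : ℝ := (1 - α - pWeight) * objective f xbar + α * objective f y +
    pWeight * (objective f xl + inner ℝ gx (xt - xl)) + α / γ * (‖x - y‖ ^ 2 / 2) - objective f y
    with hK
  let ψ : Eucl d × Fin n → ℝ := fun w => K + α ^ 2 / (2 * A) * ‖noise f xl xt w‖ ^ 2 +
    α / τ * (2 * (μ * L) ^ 2 * ‖w.1‖ ^ 6 + (d * L * ν) ^ 2 / 2) - α * inner ℝ (noise f xl xt w) z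
  have hαγ : α / γ = 12 * (d + 4) * L * α ^ 2 := by rw [hγ]; field_simp
  have hle : ∀ w : Eucl d × Fin n,
      objective f (nextBar f τ μ ν α pWeight γ xt x xbar w.1 w.2)
        - objective f y + α / γ * ((1 + τ * γ / 2) / 2 *
          ‖nextX f τ μ ν α pWeight γ xt x xbar w.1 w.2 - y‖ ^ 2) ≤ ψ w := fun w => by
    have key := prox_step (fn := objective f) (L := L) (p := pWeight) (A := A) hτ hα
      (by rw [hp]; linarith) (by linarith) hγ0 hA0
      (by
        rw [hαγ, hA]
        have : 0 ≤ 12 * (d + 4) * L * α ^ 2 * (τ * γ) := by positivity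
        linarith)
      (x := x) (xbar := xbar) (xt := xt) (xl := xl) (y := y) (gx := gx) (m := noise f xl xt w)
      (w := gradEst f μ ν xt xl w.1 w.2 - gx - noise f xl xt w)
      (x' := nextX f τ μ ν α pWeight γ xt x xbar w.1 w.2)
      (xbar' := nextBar f τ μ ν α pWeight γ xt x xbar w.1 w.2) rfl
      (by
        rw [show gx + noise f xl xt w + (gradEst f μ ν xt xl w.1 w.2 - gx - noise f xl xt w) =
          gradEst f μ ν xt xl w.1 w.2 by abel]
        rfl) rfl
      (le_of_abs_le (abs_sub_sub_inner_gradient_le h.smooth.differentiable_objective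
        (h.smooth.gradient_objective_lipschitz h.n_pos) xl _))
      (add_inner_gradient_le h.smooth.convexOn_objective h.smooth.differentiable_objective xl xbar)
      (h.strong xl y)
    have h2 := h.smooth.norm_gradEst_sub_le h.n_pos h.μ_pos h.ν_pos xt xl w
    have h3 := mul_le_mul_of_nonneg_left h2 (by positivity : 0 ≤ α / τ)
    simp only [ψ, hK]
    linarith
  obtain ⟨i1, v1⟩ := h.smooth.integral_norm_noise_sq_le hL xl xt
  obtain ⟨i2, v2⟩ := h.smooth.integral_inner_noise h.n_pos xl xt z
  have h6 := integral_sampleLaw (g := fun w : Eucl d × Fin n => ‖w.1‖ ^ 6) (fun i => by fun_prop)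
    (fun i => integrable_norm_pow_stdGaussian 6)
  have hn' : (n : ℝ) ≠ 0 := by exact_mod_cast h.n_pos.ne'
  obtain ⟨i3, v3⟩ := h6
  have v3' : ∫ w, ‖w.1‖ ^ 6 ∂(sampleLaw d n) = M := by
    rw [v3]; simp [hn', hM]
  have j1 : Integrable (fun w => α ^ 2 / (2 * A) * ‖noise f xl xt w‖ ^ 2) (sampleLaw d n) :=
    i1.const_mul _
  have j2 : Integrable (fun w => α * inner ℝ (noise f xl xt w) z) (sampleLaw d n) := i2.const_mul _
  have j3 : Integrable (fun w : Eucl d × Fin n => α / τ * (2 * (μ * L) ^ 2 * ‖w.1‖ ^ 6 +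
      (d * L * ν) ^ 2 / 2)) (sampleLaw d n) := ((i3.const_mul _).add (integrable_const _)).const_mul _
  have j4 : Integrable (fun w => K + α ^ 2 / (2 * A) * ‖noise f xl xt w‖ ^ 2) (sampleLaw d n) :=
    (integrable_const K).add j1
  have j5 : Integrable (fun w => K + α ^ 2 / (2 * A) * ‖noise f xl xt w‖ ^ 2 +
      α / τ * (2 * (μ * L) ^ 2 * ‖w.1‖ ^ 6 + (d * L * ν) ^ 2 / 2)) (sampleLaw d n) := j4.add j3
  have hψ : Integrable ψ (sampleLaw d n) := j5.sub j2
  have hψv : ∫ w, ψ w ∂(sampleLaw d n) = K + α ^ 2 / (2 * A) *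
      (∫ w, ‖noise f xl xt w‖ ^ 2 ∂(sampleLaw d n)) + α * errLevel d L τ μ ν := by
    simp only [ψ]
    rw [integral_sub j5 j2, integral_add j4 j3, integral_add (integrable_const K) j1,
      integral_const_mul, integral_const_mul, integral_const_mul, v2,
      integral_add (i3.const_mul _) (integrable_const _), integral_const_mul, v3', errLevel]
    simp
    ring
  -- The sign is inherited from the nonnegative quantity that `ψ` dominates; it lets the extended
  -- integral be computed as a Bochner integral.
  have hψ0 : ∀ w, 0 ≤ ψ w := fun w => by
    refine le_trans ?_ (hle w)
    have := h.gap_nonneg (nextBar f τ μ ν α pWeight γ xt x xbar w.1 w.2)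
    positivity
  refine (lintegral_mono fun w => ENNReal.ofReal_le_ofReal (hle w)).trans ?_
  rw [← ofReal_integral_eq_lintegral_ofReal hψ (Filter.Eventually.of_forall hψ0), hψv]
  refine ENNReal.ofReal_le_ofReal ?_
  have hB0 : 0 ≤ B := by
    have := add_inner_gradient_le h.smooth.convexOn_objective h.smooth.differentiable_objective xl xt
    linarith
  -- The noise costs at most `3d/(12d+47) ≤ 1/2 = p` times the divergence `B`, which the pivot term
  -- absorbs.
  have h7 : α ^ 2 / (2 * A) * (∫ w, ‖noise f xl xt w‖ ^ 2 ∂(sampleLaw d n)) ≤ 1 / 2 * B := by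
    have h8 := mul_le_mul_of_nonneg_left v1 (by positivity : 0 ≤ α ^ 2 / (2 * A))
    refine h8.trans ?_
    have e : α ^ 2 / (2 * A) * (6 * d * L * B) = (3 * d / (12 * d + 47)) * B := by
      rw [hA]; field_simp; ring
    rw [e]
    refine mul_le_mul_of_nonneg_right ?_ hB0
    rw [div_le_div_iff₀ (by positivity) (by norm_num)]
    have : (0 : ℝ) ≤ d := by positivity
    linarith
  rw [hK, hp]
  rw [hB] at h7
  linarith

end

noncomputable section

variable {d n : ℕ} {f : Fin n → Eucl d → ℝ} {L τ μ ν : ℝ}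

lemma SmoothConvex.continuous (hf : SmoothConvex f L) (i : Fin n) : Continuous (f i) :=
  (hf.differentiable i).continuous

/-! ### Measurability of the iterates -/

section Measurability

lemma SmoothConvex.continuous_gaussEst (hf : SmoothConvex f L) {X : Type*} [TopologicalSpace X]
    {x u : X → Eucl d} (hx : Continuous x) (hu : Continuous u) (i : Fin n) :
    Continuous (fun z => gaussEst f μ (x z) (u z) i) := by
  have hc := hf.continuous i
  unfold gaussEst
  exact (((hc.comp (hx.add (hu.const_smul μ))).sub (hc.comp hx)).div_const μ).smul hu

lemma SmoothConvex.continuous_coordEst (hf : SmoothConvex f L) : Continuous (coordEst f ν) := by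
  have hc := hf.continuous
  unfold coordEst
  fun_prop

lemma continuous_lowPoint (α p γ : ℝ) : Continuous (fun z : Eucl d × Eucl d × Eucl d =>
    lowPoint τ α p γ z.1 z.2.1 z.2.2) := by
  unfold lowPoint
  fun_prop

lemma SmoothConvex.continuous_nextX (hf : SmoothConvex f L) (α p γ : ℝ) (i : Fin n) :
    Continuous (fun z : (Eucl d × Eucl d × Eucl d) × Eucl d =>
      nextX f τ μ ν α p γ z.1.1 z.1.2.1 z.1.2.2 z.2 i) := by
  have hl : Continuous (fun z : (Eucl d × Eucl d × Eucl d) × Eucl d =>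
    lowPoint τ α p γ z.1.1 z.1.2.1 z.1.2.2) := (continuous_lowPoint α p γ).comp continuous_fst
  have h1 := hf.continuous_gaussEst (μ := μ) hl continuous_snd i
  have h2 := hf.continuous_gaussEst (μ := μ) (X := (Eucl d × Eucl d × Eucl d) × Eucl d)
    (continuous_fst.comp continuous_fst) continuous_snd i
  have h3 : Continuous (fun z : (Eucl d × Eucl d × Eucl d) × Eucl d => coordEst f ν z.1.1) :=
    hf.continuous_coordEst.comp (continuous_fst.comp continuous_fst)
  have h4 : Continuous (fun z : (Eucl d × Eucl d × Eucl d) × Eucl d => z.1.2.1) := by fun_prop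
  have h5 : Continuous (fun z : (Eucl d × Eucl d × Eucl d) × Eucl d =>
      gradEst f μ ν z.1.1 (lowPoint τ α p γ z.1.1 z.1.2.1 z.1.2.2) z.2 i) := (h1.sub h2).add h3
  unfold nextX
  exact ((h4.add (hl.const_smul (γ * τ))).sub (h5.const_smul γ)).const_smul (1 / (1 + γ * τ))

/-- The iterates are continuous in all vectors for each fixed component index, and the index is
discrete. -/
lemma measurable_of_continuous_section {X Y : Type*} [TopologicalSpace X] [MeasurableSpace X]
    [OpensMeasurableSpace X] [TopologicalSpace Y] [MeasurableSpace Y] [BorelSpace Y] {V : Type*}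
    [MeasurableSpace V] {ι : Type*} [Countable ι] [MeasurableSpace ι] [MeasurableSingletonClass ι]
    {a : V → X} (ha : Measurable a) {b : V → ι} (hb : Measurable b)
    {g : X → ι → Y} (hg : ∀ i, Continuous fun x => g x i) : Measurable fun v => g (a v) (b v) := by
  have h : Measurable (fun z : X × ι => g z.1 z.2) :=
    measurable_from_prod_countable_left fun i => (hg i).measurable
  exact h.comp (ha.prodMk hb)

lemma SmoothConvex.measurable_nextX (hf : SmoothConvex f L) (α p γ : ℝ) :
    Measurable (fun z : (Eucl d × Eucl d × Eucl d) × (Eucl d × Fin n) =>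
      nextX f τ μ ν α p γ z.1.1 z.1.2.1 z.1.2.2 z.2.1 z.2.2) := by
  have ha : Measurable (fun z : (Eucl d × Eucl d × Eucl d) × (Eucl d × Fin n) => (z.1, z.2.1)) :=
    measurable_fst.prodMk measurable_snd.fst
  have hb : Measurable (fun z : (Eucl d × Eucl d × Eucl d) × (Eucl d × Fin n) => z.2.2) :=
    measurable_snd.snd
  exact measurable_of_continuous_section ha hb
    (g := fun (z : (Eucl d × Eucl d × Eucl d) × Eucl d) (i : Fin n) =>
      nextX f τ μ ν α p γ z.1.1 z.1.2.1 z.1.2.2 z.2 i) (fun i => hf.continuous_nextX α p γ i)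

lemma SmoothConvex.measurable_nextBar (hf : SmoothConvex f L) (α p γ : ℝ) :
    Measurable (fun z : (Eucl d × Eucl d × Eucl d) × (Eucl d × Fin n) =>
      nextBar f τ μ ν α p γ z.1.1 z.1.2.1 z.1.2.2 z.2.1 z.2.2) := by
  have h := hf.measurable_nextX (τ := τ) (μ := μ) (ν := ν) α p γ
  unfold nextBar
  fun_prop

lemma SmoothConvex.measurable_loopState (hf : SmoothConvex f L) (α p γ : ℝ) (θ : ℕ → ℝ)
    {Ω : Type*} {m : MeasurableSpace Ω} {ξ : ℕ → Ω → Eucl d × Fin n} {x xt : Ω → Eucl d}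
    (hx : Measurable x) (hxt : Measurable xt) (t : ℕ) (hξ : ∀ r ≤ t, Measurable (ξ r)) :
    Measurable (fun ω => loopState f τ μ ν α p γ θ (fun r => ξ r ω) (x ω) (xt ω) t) := by
  induction t with
  | zero => exact hx.prodMk (hxt.prodMk measurable_const)
  | succ t ih =>
    have ih := ih fun r hr => hξ r (by omega)
    have hz : Measurable (fun ω =>
        ((xt ω, (loopState f τ μ ν α p γ θ (fun r => ξ r ω) (x ω) (xt ω) t).1,
          (loopState f τ μ ν α p γ θ (fun r => ξ r ω) (x ω) (xt ω) t).2.1), ξ (t + 1) ω)) :=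
      (hxt.prodMk (ih.fst.prodMk ih.snd.fst)).prodMk (hξ (t + 1) le_rfl)
    have h1 := (hf.measurable_nextX (τ := τ) (μ := μ) (ν := ν) α p γ).comp hz
    have h2 := (hf.measurable_nextBar (τ := τ) (μ := μ) (ν := ν) α p γ).comp hz
    exact h1.prodMk (h2.prodMk (ih.snd.snd.add (h2.const_smul (θ (t + 1)))))

lemma SmoothConvex.measurable_epochState (hf : SmoothConvex f L) {Ω : Type*}
    {m : MeasurableSpace Ω} {ξ : ℕ → ℕ → Ω → Eucl d × Fin n} (x0 : Eucl d) (s : ℕ)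
    (hξ : ∀ r ≤ s, ∀ t, Measurable (ξ r t)) :
    Measurable (fun ω => epochState f L τ μ ν x0 (fun s t => ξ s t ω) s) := by
  induction s with
  | zero => exact measurable_const
  | succ s ih =>
    have ih := ih fun r hr => hξ r (by omega)
    have h := hf.measurable_loopState (τ := τ) (μ := μ) (ν := ν) (alpha d n L τ (s + 1)) pWeight
      (gamma d n L τ (s + 1)) (theta d n L τ (s + 1)) ih.fst ih.snd (epochLength d n (s + 1))
      (fun r _ => hξ (s + 1) le_rfl r)
    have h2 : Measurable (fun ω =>
        (1 / ∑ t ∈ Finset.Icc 1 (epochLength d n (s + 1)), theta d n L τ (s + 1) t) •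
        (loopState f τ μ ν (alpha d n L τ (s + 1)) pWeight (gamma d n L τ (s + 1))
          (theta d n L τ (s + 1)) (fun r => ξ (s + 1) r ω)
          (epochState f L τ μ ν x0 (fun s t => ξ s t ω) s).1
          (epochState f L τ μ ν x0 (fun s t => ξ s t ω) s).2
          (epochLength d n (s + 1))).2.2) :=
      h.snd.snd.const_smul (1 / ∑ t ∈ Finset.Icc 1 (epochLength d n (s + 1)), theta d n L τ (s + 1) t)
    exact h.fst.prodMk h2

end Measurability

/-! ### Independence of a fresh sample from the past -/

section Independence

variable {Ω : Type*}

/-- The information contained in the samples with index in `S`. -/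
@[reducible]
def sampleInfo (ξ : ℕ → ℕ → Ω → Eucl d × Fin n) (S : Set (ℕ × ℕ)) : MeasurableSpace Ω :=
  ⨆ st ∈ S, MeasurableSpace.comap (ξ st.1 st.2) inferInstance

lemma measurable_sampleInfo {ξ : ℕ → ℕ → Ω → Eucl d × Fin n} {S : Set (ℕ × ℕ)} {s t : ℕ} (h : (s, t) ∈ S) :
    Measurable[sampleInfo ξ S] (ξ s t) := by
  refine Measurable.mono (comap_measurable (ξ s t)) ?_ le_rfl
  exact le_iSup₂_of_le (s, t) h le_rfl

variable [MeasurableSpace Ω] {P : Measure Ω} {ξ : ℕ → ℕ → Ω → Eucl d × Fin n}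

lemma IsSampling.sampleInfo_le (hξ : IsSampling P ξ) (S : Set (ℕ × ℕ)) :
    sampleInfo ξ S ≤ (inferInstance : MeasurableSpace Ω) :=
  iSup₂_le fun st _ => (hξ.measurable st.1 st.2).comap_le

lemma IsSampling.indepFun (hξ : IsSampling P ξ) {S : Set (ℕ × ℕ)} {s t : ℕ} (h : (s, t) ∉ S)
    {β : Type*} [MeasurableSpace β] {Z : Ω → β} (hZ : Measurable[sampleInfo ξ S] Z) :
    IndepFun Z (ξ s t) P := by
  have h1 := indep_iSup_of_disjoint (fun st : ℕ × ℕ => (hξ.measurable st.1 st.2).comap_le)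
    hξ.indep (S := S) (T := {(s, t)}) (by simpa using h)
  rw [IndepFun_iff_Indep]
  refine indep_of_indep_of_le_left (indep_of_indep_of_le_right h1 ?_) hZ.comap_le
  exact le_iSup₂_of_le (s, t) rfl le_rfl

/-- Freezing: a state built from other samples is independent of `ξ s t`, so the joint law is a
product and Tonelli applies. Extended integrals avoid assuming integrability of the next iterate. -/
lemma IsSampling.lintegral_comp [IsProbabilityMeasure P] (hξ : IsSampling P ξ) {S : Set (ℕ × ℕ)} {s t : ℕ} (h : (s, t) ∉ S)
    {β : Type*} [MeasurableSpace β] {Z : Ω → β} (hZ : Measurable[sampleInfo ξ S] Z)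
    {H : β × (Eucl d × Fin n) → ENNReal} (hH : Measurable H) :
    ∫⁻ ω, H (Z ω, ξ s t ω) ∂P = ∫⁻ ω, ∫⁻ w, H (Z ω, w) ∂(sampleLaw d n) ∂P := by
  have hZ' : Measurable Z := hZ.mono (hξ.sampleInfo_le S) le_rfl
  have h1 := (hξ.indepFun h hZ).map_prod_eq_prod_map_map hZ'.aemeasurable
    (hξ.measurable s t).aemeasurable
  have e1 : ∫⁻ ω, H (Z ω, ξ s t ω) ∂P = ∫⁻ z, H z ∂(P.map fun ω => (Z ω, ξ s t ω)) :=
    (lintegral_map hH (hZ'.prodMk (hξ.measurable s t))).symm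
  rw [e1, h1, hξ.law]
  change ∫⁻ z, H z ∂((P.map Z).prod (sampleLaw d n)) = _
  rw [lintegral_prod _ hH.aemeasurable, lintegral_map hH.lintegral_prod_right' hZ']

end Independence

/-- A single inequality of extended integrals gives both integrability and the bound, so finiteness
propagates along the iterations without separate moment estimates. -/
lemma integrable_of_lintegral_le {Ω : Type*} [MeasurableSpace Ω] {P : Measure Ω} {Q R : Ω → ℝ}
    (hQ : Measurable Q) (hQ0 : ∀ ω, 0 ≤ Q ω) (hR : Integrable R P) (hR0 : ∀ ω, 0 ≤ R ω)
    (h : ∫⁻ ω, ENNReal.ofReal (Q ω) ∂P ≤ ∫⁻ ω, ENNReal.ofReal (R ω) ∂P) :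
    Integrable Q P ∧ ∫ ω, Q ω ∂P ≤ ∫ ω, R ω ∂P := by
  rw [← ofReal_integral_eq_lintegral_ofReal hR (Filter.Eventually.of_forall hR0)] at h
  have hi : Integrable Q P := by
    rw [← lintegral_ofReal_ne_top_iff_integrable hQ.aestronglyMeasurable
      (Filter.Eventually.of_forall hQ0)]
    exact (h.trans_lt ENNReal.ofReal_lt_top).ne
  refine ⟨hi, ?_⟩
  rw [← ofReal_integral_eq_lintegral_ofReal hi (Filter.Eventually.of_forall hQ0)] at h
  exact (ENNReal.ofReal_le_ofReal_iff (integral_nonneg hR0)).1 h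

/-! ### Expected progress from a random state -/

section Expectation

variable {Ω : Type*} [MeasurableSpace Ω] {P : Measure Ω} [IsProbabilityMeasure P]
  {ξ : ℕ → ℕ → Ω → Eucl d × Fin n} {y : Eucl d}

lemma Setting.measurable_gap (h : Setting f L τ μ ν y) :
    Measurable (fun x => objective f x - objective f y) :=
  (h.smooth.differentiable_objective.continuous.sub continuous_const).measurable

/-- Expected progress of one inner iteration from a random state. -/
lemma Setting.expect_step (h : Setting f L τ μ ν y) (hξ : IsSampling P ξ) {α γ : ℝ} (hα : 0 < α)
    (hα2 : α ≤ 1 / 2) (hγ : γ = 1 / (12 * (d + 4) * L * α)) {S : Set (ℕ × ℕ)} {s t : ℕ}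
    (hst : (s, t) ∉ S) {xt x xbar : Ω → Eucl d} (hxt : Measurable[sampleInfo ξ S] xt)
    (hx : Measurable[sampleInfo ξ S] x) (hxbar : Measurable[sampleInfo ξ S] xbar)
    (ixt : Integrable (fun ω => objective f (xt ω) - objective f y) P)
    (ixbar : Integrable (fun ω => objective f (xbar ω) - objective f y) P)
    (ix : Integrable (fun ω => ‖x ω - y‖ ^ 2) P) :
    let x' := fun ω => nextX f τ μ ν α pWeight γ (xt ω) (x ω) (xbar ω) (ξ s t ω).1 (ξ s t ω).2
    let xbar' := fun ω => nextBar f τ μ ν α pWeight γ (xt ω) (x ω) (xbar ω) (ξ s t ω).1 (ξ s t ω).2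
    Integrable (fun ω => objective f (xbar' ω) - objective f y) P ∧
    Integrable (fun ω => ‖x' ω - y‖ ^ 2) P ∧
    ∫ ω, (objective f (xbar' ω) - objective f y) ∂P +
        α / γ * ((1 + τ * γ / 2) / 2 * ∫ ω, ‖x' ω - y‖ ^ 2 ∂P) ≤
      (1 - α - pWeight) * ∫ ω, (objective f (xbar ω) - objective f y) ∂P +
        pWeight * ∫ ω, (objective f (xt ω) - objective f y) ∂P +
        α / γ * ((∫ ω, ‖x ω - y‖ ^ 2 ∂P) / 2) + α * errLevel d L τ μ ν := by
  intro x' xbar'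
  have hL := h.L_pos
  have hτ := h.τ_pos
  have hγ0 : 0 < γ := by rw [hγ]; positivity
  have hp : pWeight = 1 / 2 := rfl
  have hc : 0 < α / γ * ((1 + τ * γ / 2) / 2) := by positivity
  have herr : 0 ≤ errLevel d L τ μ ν := errLevel_nonneg hτ
  have mZ : Measurable[sampleInfo ξ S] (fun ω => (xt ω, x ω, xbar ω)) := hxt.prodMk (hx.prodMk hxbar)
  have mZ' : Measurable (fun ω => ((xt ω, x ω, xbar ω), ξ s t ω)) :=
    (mZ.mono (hξ.sampleInfo_le S) le_rfl).prodMk (hξ.measurable s t)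
  have mF := (h.measurable_gap.comp (h.smooth.measurable_nextBar (τ := τ) (μ := μ) (ν := ν)
    α pWeight γ))
  have mD : Measurable (fun z : (Eucl d × Eucl d × Eucl d) × (Eucl d × Fin n) =>
      ‖nextX f τ μ ν α pWeight γ z.1.1 z.1.2.1 z.1.2.2 z.2.1 z.2.2 - y‖ ^ 2) :=
    (((h.smooth.measurable_nextX (τ := τ) (μ := μ) (ν := ν) α pWeight γ).sub_const y).norm).pow_const 2
  have mQ : Measurable (fun z : (Eucl d × Eucl d × Eucl d) × (Eucl d × Fin n) =>
      objective f (nextBar f τ μ ν α pWeight γ z.1.1 z.1.2.1 z.1.2.2 z.2.1 z.2.2)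
        - objective f y + α / γ * ((1 + τ * γ / 2) / 2 *
        ‖nextX f τ μ ν α pWeight γ z.1.1 z.1.2.1 z.1.2.2 z.2.1 z.2.2 - y‖ ^ 2)) :=
    mF.add ((mD.const_mul _).const_mul _)
  let R : Ω → ℝ := fun ω => (1 - α - pWeight) * (objective f (xbar ω) - objective f y) +
        pWeight * (objective f (xt ω) - objective f y) + α / γ * (‖x ω - y‖ ^ 2 / 2) +
        α * errLevel d L τ μ ν
  have j1 := ixbar.const_mul (1 - α - pWeight)
  have j2 := ixt.const_mul pWeight
  have j3 := (ix.div_const 2).const_mul (α / γ)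
  have j12 : Integrable (fun ω => (1 - α - pWeight) * (objective f (xbar ω) - objective f y) +
        pWeight * (objective f (xt ω) - objective f y)) P := j1.add j2
  have j123 : Integrable (fun ω => (1 - α - pWeight) * (objective f (xbar ω) - objective f y) +
        pWeight * (objective f (xt ω) - objective f y) + α / γ * (‖x ω - y‖ ^ 2 / 2)) P := j12.add j3
  have hR : Integrable R P := j123.add (integrable_const _)
  have hR0 : ∀ ω, 0 ≤ R ω := fun ω => by
    have h1 := h.gap_nonneg (xbar ω)
    have h2 := h.gap_nonneg (xt ω)
    have h3 : 0 ≤ 1 - α - pWeight := by rw [hp]; linarith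
    have h4 : 0 ≤ pWeight := by rw [hp]; norm_num
    simp only [R]
    positivity
  have hvR : ∫ ω, R ω ∂P = (1 - α - pWeight) * ∫ ω, (objective f (xbar ω) - objective f y) ∂P +
        pWeight * ∫ ω, (objective f (xt ω) - objective f y) ∂P +
        α / γ * ((∫ ω, ‖x ω - y‖ ^ 2 ∂P) / 2) + α * errLevel d L τ μ ν := by
    simp only [R]
    rw [integral_add j123 (integrable_const _), integral_add j12 j3, integral_add j1 j2,
      integral_const_mul, integral_const_mul, integral_const_mul, integral_div]
    simp
  have hlint := hξ.lintegral_comp hst mZ mQ.ennreal_ofReal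
  have key := integrable_of_lintegral_le (P := P) (mQ.comp mZ')
    (fun ω => by
      have := h.gap_nonneg (xbar' ω)
      exact add_nonneg this (by positivity)) hR hR0
    (hlint.le.trans (lintegral_mono fun ω => h.lintegral_step_le hα hα2 hγ (xt ω) (x ω) (xbar ω)))
  obtain ⟨iQ, hQ⟩ := key
  have iF : Integrable (fun ω => objective f (xbar' ω) - objective f y) P := by
    refine iQ.mono' (mF.comp mZ').aestronglyMeasurable (Filter.Eventually.of_forall fun ω => ?_)
    rw [Real.norm_of_nonneg (h.gap_nonneg _)]
    exact le_add_of_nonneg_right (by positivity)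
  -- The sum is integrable and so is the gap; the difference is a positive multiple of the squared
  -- distance.
  have iD : Integrable (fun ω => ‖x' ω - y‖ ^ 2) P := by
    have := (iQ.sub iF).const_mul (α / γ * ((1 + τ * γ / 2) / 2))⁻¹
    refine this.congr (Filter.Eventually.of_forall fun ω => ?_)
    simp only [Pi.sub_apply, Function.comp_apply, xbar', x']
    rw [add_sub_cancel_left, ← mul_assoc (α / γ), inv_mul_cancel_left₀ hc.ne']
  refine ⟨iF, iD, ?_⟩
  rw [← hvR]
  refine le_trans (le_of_eq ?_) hQ
  rw [← integral_const_mul, ← integral_const_mul, ← integral_add iF ((iD.const_mul _).const_mul _)]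
  rfl

end Expectation

end

noncomputable section

/-! ### Step sizes and averaging weights -/

section Parameters

variable {d n : ℕ} {L τ : ℝ}

lemma alpha_of_le {s : ℕ} (hs : s ≤ s₀ d n) : alpha d n L τ s = 1 / 2 := if_pos hs

lemma alpha_of_lt {s : ℕ} (hs : s₀ d n < s) :
    alpha d n L τ s = min (Real.sqrt (n * τ / (24 * L))) (1 / 2) := if_neg (by omega)

lemma alpha_pos (hn : 0 < n) (hL : 0 < L) (hτ : 0 < τ) (s : ℕ) : 0 < alpha d n L τ s := by
  have hn' : (0 : ℝ) < n := by exact_mod_cast hn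
  unfold alpha
  split_ifs
  · norm_num
  · exact lt_min (Real.sqrt_pos.2 (by positivity)) (by norm_num)

lemma alpha_le_half (s : ℕ) : alpha d n L τ s ≤ 1 / 2 := by
  unfold alpha
  split_ifs
  · exact le_rfl
  · exact min_le_right _ _

lemma alpha_sq_le (hL : 0 < L) (hτ : 0 < τ) {s : ℕ} (hs : s₀ d n < s) :
    alpha d n L τ s ^ 2 ≤ n * τ / (24 * L) := by
  have h0 : 0 ≤ alpha d n L τ s := by
    rw [alpha_of_lt hs]; exact le_min (Real.sqrt_nonneg _) (by norm_num)
  calc alpha d n L τ s ^ 2 ≤ Real.sqrt (n * τ / (24 * L)) ^ 2 := by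
        gcongr
        rw [alpha_of_lt hs]; exact min_le_left _ _
    _ = _ := Real.sq_sqrt (by positivity)

lemma gamma_pos (hn : 0 < n) (hL : 0 < L) (hτ : 0 < τ) (s : ℕ) : 0 < gamma d n L τ s := by
  have := alpha_pos (d := d) hn hL hτ s
  unfold gamma
  positivity

lemma epochLength_pos (s : ℕ) : 0 < epochLength d n s := by
  unfold epochLength
  split_ifs <;> positivity

/-- In the first phase `α + p = 1`, so both branches of the weight agree. -/
lemma theta_of_le (hL : 0 < L) {s : ℕ} (hs : s ≤ s₀ d n) (t : ℕ) :
    theta d n L τ s t = 1 / (3 * (d + 4) * L) := by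
  have e : gamma d n L τ s / alpha d n L τ s = 1 / (3 * (d + 4) * L) := by
    rw [gamma, alpha_of_le hs]; field_simp; norm_num
  unfold theta
  rw [if_pos hs, e, alpha_of_le hs, pWeight]
  split_ifs
  · norm_num
  · rfl

/-- Makes `Γ_{t-1} - (1-α-p) Γ_t` nonnegative, as Jensen requires. If `α = 1/2` the left factor is
zero; otherwise `τγ/2 = α/(n(d+4)) ≤ 1`. -/
lemma one_add_tau_gamma_le (hn : 0 < n) (hL : 0 < L) (hτ : 0 < τ) {s : ℕ}
    (hs : s₀ d n < s) :
    (1 - alpha d n L τ s - pWeight) * (1 + τ * gamma d n L τ s / 2) ≤ 1 := by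
  have hα := alpha_pos (d := d) hn hL hτ s
  have hp : pWeight = 1 / 2 := rfl
  rcases le_total (1 / 2) (Real.sqrt (n * τ / (24 * L))) with h | h
  · have : alpha d n L τ s = 1 / 2 := by rw [alpha_of_lt hs, min_eq_right h]
    rw [this, hp]; norm_num
  · have e : alpha d n L τ s = Real.sqrt (n * τ / (24 * L)) := by rw [alpha_of_lt hs, min_eq_left h]
    have h2 : alpha d n L τ s ^ 2 = n * τ / (24 * L) := by
      rw [e]; exact Real.sq_sqrt (by positivity)
    have hn' : (1 : ℝ) ≤ n := by exact_mod_cast hn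
    have h3 : τ * gamma d n L τ s / 2 = alpha d n L τ s / (n * (d + 4)) := by
      have hn0 : (0 : ℝ) < n := by linarith
      have : τ = alpha d n L τ s ^ 2 * (24 * L) / n := by
        rw [h2]; field_simp
      rw [gamma]
      set a := alpha d n L τ s
      rw [this]
      field_simp
      norm_num
    have hα2 := alpha_le_half (d := d) (n := n) (L := L) (τ := τ) s
    have h4 : alpha d n L τ s / (n * (d + 4)) ≤ 1 := by
      rw [div_le_one (by positivity)]
      have : (0 : ℝ) ≤ d := by positivity
      nlinarith
    rw [h3, hp]
    have : 0 < alpha d n L τ s / (n * (d + 4)) := by positivity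
    nlinarith

lemma theta_nonneg (hn : 0 < n) (hL : 0 < L) (hτ : 0 < τ) (s : ℕ) {t : ℕ} (ht : 1 ≤ t) :
    0 ≤ theta d n L τ s t := by
  have hγ := gamma_pos (d := d) hn hL hτ s
  rcases le_or_gt s (s₀ d n) with hs | hs
  · rw [theta_of_le hL hs]; positivity
  · unfold theta
    rw [if_neg (by omega)]
    unfold bigGamma
    split_ifs
    · obtain ⟨t, rfl⟩ := Nat.exists_eq_add_of_le' ht
      have h1 := one_add_tau_gamma_le hn hL hτ hs
      have h2 : 0 ≤ (1 + τ * gamma d n L τ s / 2) ^ t := by positivity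
      rw [Nat.add_sub_cancel, pow_succ]
      nlinarith
    · positivity

lemma sum_theta_pos (hn : 0 < n) (hL : 0 < L) (hτ : 0 < τ) (s : ℕ) :
    0 < ∑ t ∈ Finset.Icc 1 (epochLength d n s), theta d n L τ s t := by
  have hT := epochLength_pos (d := d) (n := n) s
  refine Finset.sum_pos' (fun t ht => theta_nonneg hn hL hτ s (Finset.mem_Icc.1 ht).1)
    ⟨epochLength d n s, Finset.mem_Icc.2 ⟨hT, le_rfl⟩, ?_⟩
  have hα := alpha_pos (d := d) hn hL hτ s
  have hγ := gamma_pos (d := d) hn hL hτ s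
  unfold theta bigGamma
  split_ifs <;> first | omega | positivity

end Parameters

/-- Recursive bounds on the expectations in one epoch, where `A, A'` are the expected gaps at
`x̃^{s-1}, x̃^s` and `D, D'` the expected squared distances of `x^{s-1}, x^s` to the minimiser. -/
def EpochBound (d n : ℕ) (L τ err : ℝ) (s : ℕ) (A D A' D' : ℝ) : Prop :=
  ∃ a b : ℕ → ℝ, a 0 = A ∧ b 0 = D ∧ (∀ t, 0 ≤ a t) ∧ (∀ t, 0 ≤ b t) ∧
    (∀ t, a (t + 1) + alpha d n L τ s / gamma d n L τ s *
        ((1 + τ * gamma d n L τ s / 2) / 2 * b (t + 1)) ≤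
      (1 - alpha d n L τ s - pWeight) * a t + pWeight * A +
        alpha d n L τ s / gamma d n L τ s * (b t / 2) + alpha d n L τ s * err) ∧
    (∑ t ∈ Finset.Icc 1 (epochLength d n s), theta d n L τ s t) * A' ≤
      ∑ t ∈ Finset.Icc 1 (epochLength d n s), theta d n L τ s t * a t ∧
    D' = b (epochLength d n s)

/-! ### From inner iterations to the recursion of an epoch -/

section Loop

variable {d n : ℕ} {f : Fin n → Eucl d → ℝ} {L τ μ ν : ℝ}

lemma loopState_acc (τ μ ν α p γ : ℝ) (θ : ℕ → ℝ) (ξ : ℕ → Eucl d × Fin n) (x xt : Eucl d)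
    (t : ℕ) : (loopState f τ μ ν α p γ θ ξ x xt t).2.2 =
      ∑ r ∈ Finset.Icc 1 t, θ r • (loopState f τ μ ν α p γ θ ξ x xt r).2.1 := by
  induction t with
  | zero => simp [loopState]
  | succ t ih =>
    rw [Finset.sum_Icc_succ_top (by omega), ← ih]
    rfl

lemma sampleInfo_mono {Ω : Type*} {ξ : ℕ → ℕ → Ω → Eucl d × Fin n} {S T : Set (ℕ × ℕ)} (h : S ⊆ T) :
    sampleInfo ξ S ≤ sampleInfo ξ T :=
  biSup_mono h

variable {Ω : Type*} [MeasurableSpace Ω] {P : Measure Ω} [IsProbabilityMeasure P]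
  {ξ : ℕ → ℕ → Ω → Eucl d × Fin n} {y : Eucl d}

lemma Setting.epochBound (h : Setting f L τ μ ν y) (hξ : IsSampling P ξ) (s : ℕ)
    {x xt : Ω → Eucl d} (hx : Measurable[sampleInfo ξ {st | st.1 < s}] x)
    (hxt : Measurable[sampleInfo ξ {st | st.1 < s}] xt)
    (ix : Integrable (fun ω => ‖x ω - y‖ ^ 2) P)
    (ixt : Integrable (fun ω => objective f (xt ω) - objective f y) P) :
    let z := fun ω => loopState f τ μ ν (alpha d n L τ s) pWeight (gamma d n L τ s)
      (theta d n L τ s) (fun r => ξ s r ω) (x ω) (xt ω) (epochLength d n s)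
    let xt' := fun ω =>
      (1 / ∑ t ∈ Finset.Icc 1 (epochLength d n s), theta d n L τ s t) • (z ω).2.2
    Integrable (fun ω => ‖(z ω).1 - y‖ ^ 2) P ∧
    Integrable (fun ω => objective f (xt' ω) - objective f y) P ∧
    EpochBound d n L τ (errLevel d L τ μ ν) s
      (∫ ω, (objective f (xt ω) - objective f y) ∂P) (∫ ω, ‖x ω - y‖ ^ 2 ∂P)
      (∫ ω, (objective f (xt' ω) - objective f y) ∂P) (∫ ω, ‖(z ω).1 - y‖ ^ 2 ∂P) := by
  intro z xt'
  have hn := h.n_pos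
  have hL := h.L_pos
  have hτ := h.τ_pos
  set α := alpha d n L τ s with hα
  set γ := gamma d n L τ s with hγ
  set θ := theta d n L τ s with hθ
  set T := epochLength d n s with hT
  let Z : ℕ → Ω → Eucl d × Eucl d × Eucl d := fun t ω =>
    loopState f τ μ ν α pWeight γ θ (fun r => ξ s r ω) (x ω) (xt ω) t
  -- The past of iteration `t + 1`: all samples of earlier epochs and those of this epoch up to
  -- index `t`.
  let S : ℕ → Set (ℕ × ℕ) := fun t => {st | st.1 < s ∨ (st.1 = s ∧ st.2 ≤ t)}
  have hS : ∀ t, {st : ℕ × ℕ | st.1 < s} ⊆ S t := fun t st hst => Or.inl hst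
  have mx : ∀ t, Measurable[sampleInfo ξ (S t)] x := fun t =>
    hx.mono (sampleInfo_mono (hS t)) le_rfl
  have mxt : ∀ t, Measurable[sampleInfo ξ (S t)] xt := fun t =>
    hxt.mono (sampleInfo_mono (hS t)) le_rfl
  have mZ : ∀ t, Measurable[sampleInfo ξ (S t)] (Z t) := fun t =>
    h.smooth.measurable_loopState (m := sampleInfo ξ (S t)) α pWeight γ θ (mx t) (mxt t) t
      fun r hr => measurable_sampleInfo (Or.inr ⟨rfl, hr⟩)
  have hmem : ∀ t, (s, t + 1) ∉ S t := fun t ht => by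
    rcases ht with h | h
    · exact lt_irrefl _ h
    · have := h.2
      simp only at this
      omega
  have step := fun t (h1 : Integrable (fun ω => objective f (Z t ω).2.1 - objective f y) P)
      (h2 : Integrable (fun ω => ‖(Z t ω).1 - y‖ ^ 2) P) =>
    h.expect_step hξ (alpha_pos (d := d) hn hL hτ s) (alpha_le_half s) (γ := γ) rfl (hmem t) (mxt t)
      (mZ t).fst (mZ t).snd.fst ixt h1 h2
  have hint : ∀ t, Integrable (fun ω => objective f (Z t ω).2.1 - objective f y) P ∧
      Integrable (fun ω => ‖(Z t ω).1 - y‖ ^ 2) P := fun t => by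
    induction t with
    | zero => exact ⟨ixt, ix⟩
    | succ t ih => exact ⟨(step t ih.1 ih.2).1, (step t ih.1 ih.2).2.1⟩
  have hΘ := sum_theta_pos (d := d) hn hL hτ s
  rw [← hT, ← hθ] at hΘ
  -- Jensen for the weighted average that defines the next pivot.
  have hjensen : ∀ ω, objective f (xt' ω) - objective f y ≤
      (∑ t ∈ Finset.Icc 1 T, θ t)⁻¹ *
        ∑ t ∈ Finset.Icc 1 T, θ t * (objective f (Z t ω).2.1 - objective f y) := fun ω => by
    have h1 := h.smooth.convexOn_objective.map_centerMass_le (t := Finset.Icc 1 T) (w := θ)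
      (p := fun t => (Z t ω).2.1)
      (fun t ht => theta_nonneg hn hL hτ s (Finset.mem_Icc.1 ht).1) hΘ (fun t _ => mem_univ _)
    have e : (Finset.Icc 1 T).centerMass θ (fun t => (Z t ω).2.1) = xt' ω := by
      simp only [xt', z]
      rw [loopState_acc, Finset.centerMass, one_div]
    rw [e, Finset.centerMass, smul_eq_mul] at h1
    simp only [mul_sub, Finset.sum_sub_distrib, ← Finset.sum_mul]
    rw [inv_mul_cancel_left₀ hΘ.ne']
    simpa using h1
  have hisum : Integrable (fun ω => ∑ t ∈ Finset.Icc 1 T,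
      θ t * (objective f (Z t ω).2.1 - objective f y)) P :=
    integrable_finsetSum _ fun t _ => (hint t).1.const_mul _
  have mxt' : Measurable xt' := by
    have := ((mZ T).mono (hξ.sampleInfo_le _) le_rfl).snd.snd
    exact this.const_smul (1 / ∑ t ∈ Finset.Icc 1 T, θ t)
  have ixt' : Integrable (fun ω => objective f (xt' ω) - objective f y) P := by
    refine (hisum.const_mul (∑ t ∈ Finset.Icc 1 T, θ t)⁻¹).mono' (h.measurable_gap.comp mxt').aestronglyMeasurable
      (Filter.Eventually.of_forall fun ω => ?_)
    rw [Real.norm_of_nonneg (h.gap_nonneg _)]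
    exact hjensen ω
  refine ⟨(hint T).2, ixt', fun t => ∫ ω, (objective f (Z t ω).2.1 - objective f y) ∂P,
    fun t => ∫ ω, ‖(Z t ω).1 - y‖ ^ 2 ∂P, rfl, rfl,
    fun t => integral_nonneg fun ω => h.gap_nonneg _,
    fun t => integral_nonneg fun ω => by positivity,
    fun t => (step t (hint t).1 (hint t).2).2.2, ?_, rfl⟩
  have h2 := integral_mono ixt' (hisum.const_mul _) hjensen
  rw [integral_const_mul, integral_finsetSum _ fun t _ => (hint t).1.const_mul _,
    le_inv_mul_iff₀ hΘ] at h2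
  simpa only [integral_const_mul] using h2

/-- The expected gaps and squared distances along the epochs. -/
lemma Setting.epochBounds (h : Setting f L τ μ ν y) (hξ : IsSampling P ξ) (x0 : Eucl d) :
    ∃ A D : ℕ → ℝ, A 0 = objective f x0 - objective f y ∧ D 0 = ‖x0 - y‖ ^ 2 ∧
      (∀ s, 0 ≤ A s) ∧ (∀ s, 0 ≤ D s) ∧
      (∀ s, EpochBound d n L τ (errLevel d L τ μ ν) (s + 1) (A s) (D s) (A (s + 1)) (D (s + 1))) ∧
      ∀ s, Integrable (fun ω =>
          objective f (epochState f L τ μ ν x0 (fun s t => ξ s t ω) s).2 - objective f y) P ∧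
        ∫ ω, (objective f (epochState f L τ μ ν x0 (fun s t => ξ s t ω) s).2 - objective f y) ∂P
          = A s := by
  let Z : ℕ → Ω → Eucl d × Eucl d := fun s ω => epochState f L τ μ ν x0 (fun s t => ξ s t ω) s
  have mZ : ∀ s, Measurable[sampleInfo ξ {st | st.1 < s + 1}] (Z s) := fun s =>
    h.smooth.measurable_epochState (m := sampleInfo ξ {st | st.1 < s + 1}) x0 s
      fun r hr t => measurable_sampleInfo (Nat.lt_succ_of_le hr)
  have step := fun s (h1 : Integrable (fun ω => ‖(Z s ω).1 - y‖ ^ 2) P)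
      (h2 : Integrable (fun ω => objective f (Z s ω).2 - objective f y) P) =>
    h.epochBound hξ (s + 1) (mZ s).fst (mZ s).snd h1 h2
  have hint : ∀ s, Integrable (fun ω => ‖(Z s ω).1 - y‖ ^ 2) P ∧
      Integrable (fun ω => objective f (Z s ω).2 - objective f y) P := fun s => by
    induction s with
    | zero => exact ⟨integrable_const (‖x0 - y‖ ^ 2), integrable_const (objective f x0 - objective f y)⟩
    | succ s ih => exact ⟨(step s ih.1 ih.2).1, (step s ih.1 ih.2).2.1⟩
  refine ⟨fun s => ∫ ω, (objective f (Z s ω).2 - objective f y) ∂P,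
    fun s => ∫ ω, ‖(Z s ω).1 - y‖ ^ 2 ∂P, ?_, ?_,
    fun s => integral_nonneg fun ω => h.gap_nonneg _,
    fun s => integral_nonneg fun ω => by positivity,
    fun s => (step s (hint s).1 (hint s).2).2.2, fun s => ⟨(hint s).2, rfl⟩⟩
  · simp [Z, epochState]
  · simp [Z, epochState]

end Loop

end

/-! ### The two phases as recursions for real sequences -/

noncomputable section

variable {d n : ℕ} {L τ err : ℝ}

lemma epochLength_of_le {s : ℕ} (hs : s ≤ s₀ d n) : epochLength d n s = 2 ^ (s - 1) := if_pos hs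

lemma le_two_pow_s₀ (d n : ℕ) : (d + 4) * n ≤ 2 ^ s₀ d n :=
  (Nat.lt_pow_succ_log_self (by norm_num) _).le

lemma two_pow_s₀_le (hn : 0 < n) : 2 ^ s₀ d n ≤ 2 * ((d + 4) * n) := by
  rw [s₀, pow_succ, mul_comm]
  exact Nat.mul_le_mul_left 2 (Nat.pow_log_le_self 2 (by positivity))

/-- With `α = p = 1/2` the term in `a t` disappears and the distances telescope with equal weights
over `2^s` iterations; the statement is twice that sum. -/
lemma EpochBound.initial_phase (hL : 0 < L) (hτ : 0 < τ) {s : ℕ}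
    (hs : s + 1 ≤ s₀ d n) {A D A' D' : ℝ} (h : EpochBound d n L τ err (s + 1) A D A' D') :
    2 ^ (s + 1) * A' + 3 * (d + 4) * L * D' ≤ 2 ^ s * A + 3 * (d + 4) * L * D + 2 ^ s * err := by
  obtain ⟨a, b, ha0, hb0, -, hb, hstep, hsum, rfl⟩ := h
  set c : ℝ := 3 * (d + 4) * L with hc
  have hc0 : 0 < c := by positivity
  have hγ : gamma d n L τ (s + 1) = 1 / (2 * c) := by
    rw [gamma, alpha_of_le hs, hc]; congr 1; ring
  have hstep' : ∀ t, a (t + 1) + c / 2 * b (t + 1) ≤ (A + err) / 2 + c / 2 * b t := fun t => by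
    have h1 := hstep t
    rw [alpha_of_le hs, hγ, show (1 : ℝ) / 2 / (1 / (2 * c)) = c by field_simp, pWeight] at h1
    have h2 : 0 ≤ c * (τ * (1 / (2 * c)) / 2 / 2 * b (t + 1)) := by
      have := hb (t + 1); positivity
    linarith
  have hT : ∀ T : ℕ, ∑ t ∈ Finset.Icc 1 T, a t + c / 2 * b T ≤ T * ((A + err) / 2) + c / 2 * D := by
    intro T
    induction T with
    | zero => simp [hb0]
    | succ T ih =>
      rw [Finset.sum_Icc_succ_top (by omega)]
      have := hstep' T
      push_cast
      linarith
  have h1 := hT (epochLength d n (s + 1))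
  simp only [theta_of_le hL hs, ← Finset.mul_sum, Finset.sum_const, Nat.card_Icc,
    Nat.add_sub_cancel, nsmul_eq_mul] at hsum
  rw [mul_comm _ (1 / (3 * (d + 4) * L)), mul_assoc] at hsum
  have h2 := le_of_mul_le_mul_left hsum (by positivity)
  have e : ((epochLength d n (s + 1) : ℕ) : ℝ) = 2 ^ s := by
    rw [epochLength_of_le hs]; simp
  rw [e] at h1 h2
  rw [pow_succ]
  linarith

/-- The bounds for the first `s₀` epochs. -/
lemma initial_phase_bound (hL : 0 < L) (hτ : 0 < τ) (herr : 0 ≤ err) {A D : ℕ → ℝ}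
    (h : ∀ s, EpochBound d n L τ err (s + 1) (A s) (D s) (A (s + 1)) (D (s + 1))) {s : ℕ}
    (hs : s ≤ s₀ d n) :
    2 ^ s * A s + 3 * (d + 4) * L * D s ≤ A 0 + 3 * (d + 4) * L * D 0 + 2 ^ s * err := by
  induction s with
  | zero => simp [herr]
  | succ s ih =>
    have h1 := (h s).initial_phase hL hτ hs
    have h2 := ih (by omega)
    have e : (2 : ℝ) ^ (s + 1) = 2 * 2 ^ s := by ring
    rw [e] at h1 ⊢
    linarith

/-- All parameters are constant after epoch `s₀`, so every later epoch can use those of epoch `s₀ +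
1`. -/
lemma EpochBound.of_lt {s : ℕ} (hs : s₀ d n < s) {A D A' D' : ℝ}
    (h : EpochBound d n L τ err s A D A' D') :
    EpochBound d n L τ err (s₀ d n + 1) A D A' D' := by
  have hα : alpha d n L τ s = alpha d n L τ (s₀ d n + 1) := by
    rw [alpha_of_lt hs, alpha_of_lt (Nat.lt_succ_self _)]
  have hγ : gamma d n L τ s = gamma d n L τ (s₀ d n + 1) := by rw [gamma, gamma, hα]
  have hT : epochLength d n s = epochLength d n (s₀ d n + 1) := by
    rw [epochLength, epochLength, if_neg (by omega), if_neg (by omega)]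
  have hθ : theta d n L τ s = theta d n L τ (s₀ d n + 1) := by
    ext t
    simp only [theta, bigGamma, hT, hα, hγ, if_neg (not_le_of_gt hs),
      if_neg (Nat.not_succ_le_self (s₀ d n))]
  unfold EpochBound at h ⊢
  rwa [hα, hγ, hT, hθ] at h

/-- Summation of the recursion of an epoch of the second phase. -/
lemma weighted_sum_le {a b : ℕ → ℝ} {q β k A e : ℝ} (hq : 0 < q)
    (hstep : ∀ t, a (t + 1) + k * (q / 2 * b (t + 1)) ≤ β * a t + 1 / 2 * A + k * (b t / 2) + e)
    (T : ℕ) :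
    ∑ t ∈ Finset.Icc 1 T, (q ^ (t - 1) - β * q ^ t) * a t + β * q ^ T * a T + k / 2 * q ^ T * b T ≤
      β * a 0 + (∑ j ∈ Finset.range T, q ^ j) * (A / 2 + e) + k / 2 * b 0 := by
  induction T with
  | zero => simp
  | succ T ih =>
    rw [Finset.sum_Icc_succ_top (by omega), Finset.sum_range_succ, Nat.add_sub_cancel]
    -- Multiplying the recursion by `q^T` makes the distance terms telescope, and the surplus `β
    -- q^(T+1) a (T+1)` is carried to the next step.
    have h1 := mul_le_mul_of_nonneg_left (hstep T) (pow_nonneg hq.le T)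
    rw [pow_succ]
    linarith

/-- The exceptional last weight is the regular one plus the carried term `β q^T`, so the weighted
sum has the shape produced by `weighted_sum_le`. Taking `a = 1` also yields the total weight. -/
lemma sum_theta_eq (a : ℕ → ℝ) :
    ∑ t ∈ Finset.Icc 1 (epochLength d n (s₀ d n + 1)), theta d n L τ (s₀ d n + 1) t * a t =
      ∑ t ∈ Finset.Icc 1 (epochLength d n (s₀ d n + 1)),
        ((1 + τ * gamma d n L τ (s₀ d n + 1) / 2) ^ (t - 1) -
          (1 - alpha d n L τ (s₀ d n + 1) - pWeight) *
          (1 + τ * gamma d n L τ (s₀ d n + 1) / 2) ^ t) * a t +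
      (1 - alpha d n L τ (s₀ d n + 1) - pWeight) *
        (1 + τ * gamma d n L τ (s₀ d n + 1) / 2) ^ (epochLength d n (s₀ d n + 1)) *
        a (epochLength d n (s₀ d n + 1)) := by
  obtain ⟨T, hT⟩ := Nat.exists_eq_add_of_le' (epochLength_pos (d := d) (n := n) (s₀ d n + 1))
  simp only [theta, if_neg (Nat.not_succ_le_self (s₀ d n)), hT, bigGamma]
  rw [Finset.sum_Icc_succ_top (by omega), Finset.sum_Icc_succ_top (by omega)]
  have : ∀ t ∈ Finset.Icc 1 T, t < T + 1 := fun t ht => by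
    have := (Finset.mem_Icc.1 ht).2; omega
  rw [if_neg (lt_irrefl _)]
  have e : ∑ t ∈ Finset.Icc 1 T, (if t < T + 1 then
      (1 + τ * gamma d n L τ (s₀ d n + 1) / 2) ^ (t - 1) -
      (1 - alpha d n L τ (s₀ d n + 1) - pWeight) * (1 + τ * gamma d n L τ (s₀ d n + 1) / 2) ^ t
      else (1 + τ * gamma d n L τ (s₀ d n + 1) / 2) ^ (t - 1)) * a t =
      ∑ t ∈ Finset.Icc 1 T, ((1 + τ * gamma d n L τ (s₀ d n + 1) / 2) ^ (t - 1) -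
      (1 - alpha d n L τ (s₀ d n + 1) - pWeight) *
      (1 + τ * gamma d n L τ (s₀ d n + 1) / 2) ^ t) * a t :=
    Finset.sum_congr rfl fun t ht => by rw [if_pos (this t ht)]
  rw [e]
  ring

lemma sum_theta_eq_add (q β : ℝ) (T : ℕ) :
    ∑ t ∈ Finset.Icc 1 T, (q ^ (t - 1) - β * q ^ t) * 1 + β * q ^ T * 1 =
      β + (1 - β) * ∑ j ∈ Finset.range T, q ^ j := by
  induction T with
  | zero => simp
  | succ T ih =>
    rw [Finset.sum_Icc_succ_top (by omega), Finset.sum_range_succ, Nat.add_sub_cancel]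
    linarith

/-- The contraction factor of one epoch of the second phase, from the summed recursion. -/
lemma potential_contraction {R G α k Q A D A' D' : ℝ} (hR0 : 0 < R) (hRG : R ≤ G) (hα : 0 ≤ α)
    (hα2 : α ≤ 1 / 2) (hR : R = 1 - α - 1 / 2 + G / 2) (hk : 0 ≤ k) (herr : 0 ≤ err) (hA' : 0 ≤ A') (hD' : 0 ≤ D')
    (hQ : 1 + α / 2 ≤ Q)
    (h : (1 - α - 1 / 2 + (1 - (1 - α - 1 / 2)) * G) * A' + k / 2 * Q * D' ≤
      (1 - α - 1 / 2) * A + G * (A / 2 + α * err) + k / 2 * D) :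
    (1 + α / 2) * (A' + k / (2 * R) * D') ≤ A + k / (2 * R) * D + 2 * α * err := by
  -- The total weight exceeds the coefficient `R` of `A` by `αG ≥ αR`; this surplus is the
  -- contraction in the gap.
  have e2 : 1 - α - 1 / 2 + (1 - (1 - α - 1 / 2)) * G = R + α * G := by rw [hR]; ring
  have h2 : (1 - α - 1 / 2) * A + G * (A / 2 + α * err) + k / 2 * D =
      R * A + G * (α * err) + k / 2 * D := by rw [hR]; ring
  rw [e2, h2] at h
  have h3 : R * ((1 + α / 2) * A') ≤ (R + α * G) * A' := by
    have h4 : 0 ≤ α * A' := by positivity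
    have h5 := mul_le_mul_of_nonneg_right hRG h4
    have h6 : 0 ≤ R * (α * A') := by positivity
    linarith
  have h4 : k / 2 * ((1 + α / 2) * D') ≤ k / 2 * Q * D' := by
    rw [mul_assoc]
    exact mul_le_mul_of_nonneg_left (mul_le_mul_of_nonneg_right hQ hD') (by positivity)
  have h5 : G * (α * err) ≤ 2 * R * (α * err) :=
    mul_le_mul_of_nonneg_right (by linarith) (by positivity)
  have h6 : R * ((1 + α / 2) * (A' + k / (2 * R) * D')) ≤
      R * (A + k / (2 * R) * D + 2 * α * err) := by
    have e3 : R * ((1 + α / 2) * (A' + k / (2 * R) * D')) =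
        R * ((1 + α / 2) * A') + k / 2 * ((1 + α / 2) * D') := by field_simp
    have e4 : R * (A + k / (2 * R) * D + 2 * α * err) =
        R * A + k / 2 * D + 2 * R * (α * err) := by field_simp
    rw [e3, e4]
    linarith
  exact le_of_mul_le_mul_left h6 hR0

/-- The contraction in the epochs of the second phase. -/
lemma EpochBound.second_phase (hn : 0 < n) (hL : 0 < L) (hτ : 0 < τ) (herr : 0 ≤ err) :
    ∃ η : ℝ, 0 ≤ η ∧ η ≤ 6 * L / n ∧ ∀ {s : ℕ} {A D A' D' : ℝ}, s₀ d n < s →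
      0 ≤ A' → 0 ≤ D' → EpochBound d n L τ err s A D A' D' →
      (1 + alpha d n L τ (s₀ d n + 1) / 2) * (A' + η * D') ≤
        A + η * D + 2 * alpha d n L τ (s₀ d n + 1) * err := by
  set α := alpha d n L τ (s₀ d n + 1) with hα
  set γ := gamma d n L τ (s₀ d n + 1) with hγ
  set T := epochLength d n (s₀ d n + 1) with hT
  have hα0 : 0 < α := alpha_pos hn hL hτ _
  have hα2 : α ≤ 1 / 2 := alpha_le_half _
  have hγ0 : 0 < γ := gamma_pos hn hL hτ _
  have hn' : (0 : ℝ) < n := by exact_mod_cast hn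
  have hp : pWeight = 1 / 2 := rfl
  have hαγ : α / γ = 12 * (d + 4) * L * α ^ 2 := by rw [hγ, gamma, ← hα]; field_simp
  have hTn : ((d : ℝ) + 4) * n / 2 ≤ T := by
    have h1 : 2 ^ s₀ d n = 2 * T := by
      rw [hT, epochLength, if_neg (by omega), s₀, Nat.add_sub_cancel, pow_succ, mul_comm]
    have h2 := le_two_pow_s₀ d n
    rw [h1] at h2
    have h3 : (((d + 4) * n : ℕ) : ℝ) ≤ ((2 * T : ℕ) : ℝ) := by exact_mod_cast h2
    push_cast at h3
    linarith
  have hT0 : (0 : ℝ) < T := lt_of_lt_of_le (by positivity) hTn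
  set q := 1 + τ * γ / 2 with hq
  have hq0 : 0 < q := by positivity
  have hq1 : 1 ≤ q := by
    have : 0 ≤ τ * γ / 2 := by positivity
    linarith
  -- Bernoulli's inequality with `T ≥ (d+4)n/2`; the bound `α² ≤ nτ/(24L)` is exactly what gives `T
  -- τγ/2 ≥ α/2`.
  have hqT : 1 + α / 2 ≤ q ^ T := by
    have h0 : -2 ≤ τ * γ / 2 := le_trans (by norm_num) (by positivity : 0 ≤ τ * γ / 2)
    have h1 := one_add_mul_le_pow h0 T
    refine le_trans ?_ h1
    have h2 : α ^ 2 ≤ n * τ / (24 * L) := alpha_sq_le hL hτ (Nat.lt_succ_self _)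
    have h3 : τ * γ / 2 = τ / (24 * (d + 4) * L * α) := by
      rw [hγ, gamma, ← hα]; field_simp; norm_num
    have h4 : α / 2 ≤ ((d : ℝ) + 4) * n / 2 * (τ / (24 * (d + 4) * L * α)) := by
      have : ((d : ℝ) + 4) * n / 2 * (τ / (24 * (d + 4) * L * α)) = n * τ / (24 * L) / (2 * α) := by
        field_simp
      rw [this, le_div_iff₀ (by positivity)]
      linarith
    rw [h3]
    have h5 := mul_le_mul_of_nonneg_right hTn
      (by positivity : 0 ≤ τ / (24 * ((d : ℝ) + 4) * L * α))
    linarith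
  set G := ∑ j ∈ Finset.range T, q ^ j with hG
  have hGT : (T : ℝ) ≤ G := by
    have : ∑ j ∈ Finset.range T, (1 : ℝ) ≤ G := Finset.sum_le_sum fun j _ => one_le_pow₀ hq1
    simpa using this
  have hG1 : 1 ≤ G := le_trans (by exact_mod_cast epochLength_pos (s₀ d n + 1)) hGT
  set β := 1 - α - pWeight with hβ
  have hβ0 : 0 ≤ β := by rw [hβ, hp]; linarith
  have hβ1 : β ≤ 1 / 2 := by rw [hβ, hp]; linarith
  set R := β + G / 2 with hR
  have hR0 : 0 < R := by positivity
  have hRG : R ≤ G := by linarith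
  -- The ratio of the coefficients of `D` and `A` on the right of the summed recursion. It is at
  -- most `6L/n` because `α² ≤ 1/4` and `2R ≥ G ≥ T ≥ (d+4)n/2`.
  refine ⟨α / γ / (2 * R), by positivity, ?_, ?_⟩
  · rw [hαγ, div_le_div_iff₀ (by positivity) hn']
    have h1 : α ^ 2 ≤ 1 / 4 := by nlinarith
    have h2 : ((d : ℝ) + 4) * n / 2 ≤ 2 * R := by linarith
    calc 12 * ((d : ℝ) + 4) * L * α ^ 2 * n ≤ 12 * ((d : ℝ) + 4) * L * (1 / 4) * n := by gcongr
      _ = 6 * L * (((d : ℝ) + 4) * n / 2) := by ring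
      _ ≤ 6 * L * (2 * R) := by gcongr
  · intro s A D A' D' hs hA' hD' h
    obtain ⟨a, b, rfl, rfl, -, -, hstep, hsum, rfl⟩ := h.of_lt hs
    have e1 : ∑ t ∈ Finset.Icc 1 T, theta d n L τ (s₀ d n + 1) t = β + (1 - β) * G := by
      have := sum_theta_eq (d := d) (n := n) (L := L) (τ := τ) (fun _ => 1)
      rw [sum_theta_eq_add] at this
      simpa using this
    rw [sum_theta_eq a, ← hα, ← hγ, ← hT, ← hβ, ← hq, e1] at hsum
    have h1 := weighted_sum_le (a := a) (b := b) (q := q) (β := β) (k := α / γ) (A := a 0)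
      (e := α * err) hq0 hstep T
    rw [← hG] at h1
    rw [hβ, hp] at hsum h1
    exact potential_contraction hR0 hRG hα0.le hα2 (by rw [hR, hβ, hp]) (by positivity) herr hA' hD'
      hqT (by linarith)

/-- Accuracy after at most `s₀` epochs. -/
lemma gap_initial_le (hL : 0 < L) (hτ : 0 < τ) (herr : 0 ≤ err) {A D : ℕ → ℝ}
    (hD : ∀ s, 0 ≤ D s)
    (h : ∀ s, EpochBound d n L τ err (s + 1) (A s) (D s) (A (s + 1)) (D (s + 1))) {s : ℕ}
    (hs : s ≤ s₀ d n) :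
    A s ≤ (d + 4) / 2 * (2 / (d + 4) * A 0 + 6 * L * D 0) / 2 ^ s + err := by
  have h1 := initial_phase_bound hL hτ herr h hs
  have h2 : 0 ≤ 3 * ((d : ℝ) + 4) * L * D s := by have := hD s; positivity
  have e : ((d : ℝ) + 4) / 2 * (2 / (d + 4) * A 0 + 6 * L * D 0) =
    A 0 + 3 * (d + 4) * L * D 0 := by field_simp; ring
  rw [e, ← sub_le_iff_le_add, le_div_iff₀ (by positivity)]
  linarith

/-- Accuracy after more than `s₀` epochs. -/
lemma gap_second_le (hn : 0 < n) (hL : 0 < L) (hτ : 0 < τ) (herr : 0 ≤ err) {A D : ℕ → ℝ}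
    (hA : ∀ s, 0 ≤ A s) (hD : ∀ s, 0 ≤ D s)
    (h : ∀ s, EpochBound d n L τ err (s + 1) (A s) (D s) (A (s + 1)) (D (s + 1))) (k : ℕ) :
    A (s₀ d n + k) ≤ 3 / 2 * (2 / (d + 4) * A 0 + 6 * L * D 0) / n /
      (1 + alpha d n L τ (s₀ d n + 1) / 2) ^ k + 9 * err := by
  obtain ⟨η, hη0, hη, hc⟩ := EpochBound.second_phase (d := d) hn hL hτ herr
  set α := alpha d n L τ (s₀ d n + 1) with hα
  have hα0 : 0 < α := alpha_pos hn hL hτ _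
  have hn' : (0 : ℝ) < n := by exact_mod_cast hn
  set Δ := 2 / (d + 4) * A 0 + 6 * L * D 0 with hΔ
  have hΔ0 : 0 ≤ Δ := by have := hA 0; have := hD 0; positivity
  -- The additive `4 err` is the fixed point of `z ↦ (z + 2α err)/(1 + α/2)`.
  have hk : ∀ k, A (s₀ d n + k) + η * D (s₀ d n + k) ≤
      (A (s₀ d n) + η * D (s₀ d n)) / (1 + α / 2) ^ k + 4 * err := fun k => by
    induction k with
    | zero => simp [herr]
    | succ k ih =>
      have h1 := hc (s := s₀ d n + k + 1) (by omega) (hA _) (hD _) (h (s₀ d n + k))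
      have h2 : A (s₀ d n + k + 1) + η * D (s₀ d n + k + 1) ≤
          (A (s₀ d n + k) + η * D (s₀ d n + k) + 2 * α * err) / (1 + α / 2) := by
        rw [le_div_iff₀ (by positivity)]; linarith
      refine h2.trans ?_
      have h3 : ((A (s₀ d n) + η * D (s₀ d n)) / (1 + α / 2) ^ k + 4 * err + 2 * α * err) /
          (1 + α / 2) = (A (s₀ d n) + η * D (s₀ d n)) / (1 + α / 2) ^ (k + 1) + 4 * err := by
        rw [pow_succ]; field_simp; ring
      rw [← h3]
      gcongr
  have h1 := initial_phase_bound hL hτ herr h le_rfl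
  have e : A 0 + 3 * (d + 4) * L * D 0 = ((d : ℝ) + 4) / 2 * Δ := by
    rw [hΔ]; field_simp; ring
  rw [e] at h1
  have hlo : ((d : ℝ) + 4) * n ≤ 2 ^ s₀ d n := by exact_mod_cast le_two_pow_s₀ d n
  have hup : (2 : ℝ) ^ s₀ d n ≤ 2 * ((d + 4) * n) := by exact_mod_cast two_pow_s₀_le hn
  have hA1 : A (s₀ d n) ≤ Δ / (2 * n) + err := by
    have h2 : 0 ≤ 3 * ((d : ℝ) + 4) * L * D (s₀ d n) := by have := hD (s₀ d n); positivity
    have h3 : A (s₀ d n) - err ≤ ((d : ℝ) + 4) / 2 * Δ / 2 ^ s₀ d n := by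
      rw [le_div_iff₀ (by positivity)]; linarith
    have h4 : ((d : ℝ) + 4) / 2 * Δ / 2 ^ s₀ d n ≤ ((d : ℝ) + 4) / 2 * Δ / ((d + 4) * n) := by
      gcongr
    have h5 : ((d : ℝ) + 4) / 2 * Δ / ((d + 4) * n) = Δ / (2 * n) := by field_simp
    linarith
  -- The upper bound on `2^s₀` keeps the error accumulated in the distance of order `err` once it is
  -- weighted by `η ≤ 6L/n`.
  have hD1 : η * D (s₀ d n) ≤ Δ / n + 4 * err := by
    have h2 : 0 ≤ 2 ^ s₀ d n * A (s₀ d n) := by have := hA (s₀ d n); positivity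
    have h3 : (2 : ℝ) ^ s₀ d n * err ≤ 2 * ((d + 4) * n) * err :=
      mul_le_mul_of_nonneg_right hup herr
    have h4 : 3 * ((d : ℝ) + 4) * L * D (s₀ d n) ≤ (d + 4) / 2 * Δ + 2 * ((d + 4) * n) * err := by
      linarith
    have h5 : D (s₀ d n) ≤ ((d + 4) / 2 * Δ + 2 * ((d + 4) * n) * err) / (3 * ((d : ℝ) + 4) * L) := by
      rw [le_div_iff₀ (by positivity)]; linarith
    calc η * D (s₀ d n) ≤ 6 * L / n *
        (((d + 4) / 2 * Δ + 2 * ((d + 4) * n) * err) / (3 * ((d : ℝ) + 4) * L)) := by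
          exact mul_le_mul hη h5 (hD _) (by positivity)
      _ = Δ / n + 4 * err := by field_simp; ring
  have h2 := hk k
  have h3 : 0 ≤ η * D (s₀ d n + k) := mul_nonneg hη0 (hD _)
  have hpow : (1 : ℝ) ≤ (1 + α / 2) ^ k := one_le_pow₀ (by linarith)
  have h4 : (A (s₀ d n) + η * D (s₀ d n)) / (1 + α / 2) ^ k ≤
      3 / 2 * Δ / n / (1 + α / 2) ^ k + 5 * err := by
    have h5 : A (s₀ d n) + η * D (s₀ d n) ≤ 3 / 2 * Δ / n + 5 * err := by
      have : Δ / (2 * n) = 1 / 2 * (Δ / n) := by field_simp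
      have e2 : 3 / 2 * Δ / n = 3 / 2 * (Δ / n) := by ring
      rw [this] at hA1
      rw [e2]
      linarith
    calc _ ≤ (3 / 2 * Δ / n + 5 * err) / (1 + α / 2) ^ k := by gcongr
      _ = 3 / 2 * Δ / n / (1 + α / 2) ^ k + 5 * err / (1 + α / 2) ^ k := add_div _ _ _
      _ ≤ _ := by
        gcongr
        exact div_le_self (by positivity) hpow
  linarith

end

noncomputable section

/-! ### The Gaussian smoothing and the initial gap -/

section Smoothing

variable {d n : ℕ} {L τ μ : ℝ}

/-- A function with Lipschitz gradient differs little from its Gaussian smoothing. -/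
lemma smoothing_sub_bounds {g : Eucl d → ℝ} (hc : ConvexOn ℝ univ g) (hg : Differentiable ℝ g)
    (hL : ∀ x y, ‖gradient g x - gradient g y‖ ≤ L * ‖x - y‖) (x : Eucl d) :
    Integrable (fun u => g (x + μ • u)) (stdGaussian (Eucl d)) ∧ g x ≤ smoothing μ g x ∧
      smoothing μ g x ≤ g x + L / 2 * μ ^ 2 * ∫ u, ‖u‖ ^ 2 ∂(stdGaussian (Eucl d)) := by
  set r : Eucl d → ℝ := fun u => g (x + μ • u) - g x - μ * inner ℝ (gradient g x) u with hr
  have hr0 : ∀ u, 0 ≤ r u := fun u => by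
    have := add_inner_gradient_le hc hg x (x + μ • u)
    rw [add_sub_cancel_left, real_inner_smul_right] at this
    simp only [hr]; linarith
  have hr1 : ∀ u, r u ≤ L / 2 * μ ^ 2 * ‖u‖ ^ 2 := fun u => by
    have := (abs_le.1 (abs_sub_sub_inner_gradient_le hg hL x (x + μ • u))).2
    rw [add_sub_cancel_left, real_inner_smul_right, norm_smul, mul_pow, Real.norm_eq_abs, sq_abs]
      at this
    simp only [hr]; linarith
  have hgc := hg.continuous
  have ir : Integrable r (stdGaussian (Eucl d)) := by
    refine integrable_stdGaussian_of_le (by fun_prop) (L / 2 * μ ^ 2) 2 fun u => ?_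
    rw [Real.norm_of_nonneg (hr0 u)]
    exact hr1 u
  have ii : Integrable (fun u : Eucl d => (inner ℝ (gradient g x) u : ℝ)) (stdGaussian (Eucl d)) := by
    refine integrable_stdGaussian_of_le (by fun_prop) ‖gradient g x‖ 1 fun u => ?_
    rw [pow_one]
    exact norm_inner_le_norm _ _
  have e : (fun u => g (x + μ • u)) = fun u => g x + μ * inner ℝ (gradient g x) u + r u := by
    ext u; simp only [hr]; ring
  have i1 : Integrable (fun u : Eucl d => g x + μ * inner ℝ (gradient g x) u)
      (stdGaussian (Eucl d)) := (integrable_const _).add (ii.const_mul _)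
  have hv : smoothing μ g x = g x + ∫ u, r u ∂(stdGaussian (Eucl d)) := by
    rw [smoothing, e, integral_add i1 ir, integral_add (integrable_const _) (ii.const_mul _),
      integral_const_mul, integral_inner_stdGaussian]
    simp
  refine ⟨by rw [e]; exact i1.add ir, ?_, ?_⟩
  · rw [hv]
    have : 0 ≤ ∫ u, r u ∂(stdGaussian (Eucl d)) := integral_nonneg hr0
    linarith
  · rw [hv, ← integral_const_mul]
    have := integral_mono ir ((integrable_norm_pow_stdGaussian 2).const_mul (L / 2 * μ ^ 2)) hr1
    linarith

/-- Used for continuity: a finite convex function on `ℝ^d` is continuous. -/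
lemma convexOn_smoothing {g : Eucl d → ℝ} (hc : ConvexOn ℝ univ g)
    (hi : ∀ x, Integrable (fun u => g (x + μ • u)) (stdGaussian (Eucl d))) :
    ConvexOn ℝ univ (smoothing μ g) := by
  refine ⟨convex_univ, fun x _ y _ a b ha hb hab => ?_⟩
  simp only [smoothing, smul_eq_mul]
  rw [← integral_const_mul, ← integral_const_mul,
    ← integral_add ((hi x).const_mul a) ((hi y).const_mul b)]
  refine integral_mono (hi _) (((hi x).const_mul a).add ((hi y).const_mul b)) fun u => ?_
  have h := hc.2 (mem_univ (x + μ • u)) (mem_univ (y + μ • u)) ha hb hab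
  have e : a • (x + μ • u) + b • (y + μ • u) = a • x + b • y + μ • u := by
    calc _ = a • x + b • y + (a + b) • μ • u := by module
      _ = _ := by rw [hab, one_smul]
  rw [e] at h
  exact h

/-- Comparison of the gaps for the objective and for its smoothing. -/
lemma initialGap_comparison {f : Fin n → Eucl d → ℝ} (hf : SmoothConvex f L)
    (hs : StronglyConvex (objective f) τ) (hn : 0 < n) (hL : 0 < L) (hτ : 0 < τ)
    {xs xμ : Eucl d} (hxs : IsMinOn (objective f) univ xs)
    (hxμ : IsMinOn (smoothing μ (objective f)) univ xμ) (x0 : Eucl d) :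
    0 ≤ initialGap f L μ x0 xμ ∧
    2 / ((d : ℝ) + 4) * (objective f x0 - objective f xs) + 6 * L * ‖x0 - xs‖ ^ 2 ≤
      3 / 2 * initialGap f L μ x0 xμ +
        (2 + 36 * L / τ) * (L / 2 * μ ^ 2 * ∫ u, ‖u‖ ^ 2 ∂(stdGaussian (Eucl d))) := by
  set ρ := L / 2 * μ ^ 2 * ∫ u, ‖u‖ ^ 2 ∂(stdGaussian (Eucl d)) with hρ
  have hb := fun x => (smoothing_sub_bounds (μ := μ) hf.convexOn_objective
    hf.differentiable_objective (hf.gradient_objective_lipschitz hn) x).2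
  have h1 : 0 ≤ smoothing μ (objective f) x0 - smoothing μ (objective f) xμ :=
    sub_nonneg.2 (hxμ (mem_univ x0))
  have h2 : smoothing μ (objective f) xμ ≤ smoothing μ (objective f) xs := hxμ (mem_univ xs)
  have h3 := hs.norm_sq_le hxs xμ
  have h4 := (hb x0).1
  have h5 := (hb xs).2
  have h6 := (hb xμ).1
  have hρ0 : 0 ≤ ρ := by linarith [(hb xs).1]
  -- The chain `f(xμ) ≤ f_μ(xμ) ≤ f_μ(xs) ≤ f(xs) + ρ` makes `xμ` nearly optimal for `f`, and strong
  -- convexity brings it close to `xs`.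
  have h7 : ‖xμ - xs‖ ^ 2 ≤ 2 * ρ / τ := by
    rw [le_div_iff₀ hτ]; linarith
  -- The factor `3/2` must stay below `2`: with `2` the first phase would leave no slack at `D₀ =
  -- nε`.
  have h8 : ‖x0 - xs‖ ^ 2 ≤ 3 / 2 * ‖x0 - xμ‖ ^ 2 + 3 * ‖xμ - xs‖ ^ 2 := by
    have h9 : ‖x0 - xs‖ ≤ ‖x0 - xμ‖ + ‖xμ - xs‖ := norm_sub_le_norm_sub_add_norm_sub _ _ _
    have h10 : ‖x0 - xs‖ ^ 2 ≤ (‖x0 - xμ‖ + ‖xμ - xs‖) ^ 2 := by gcongr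
    linarith [sq_nonneg (‖x0 - xμ‖ - 2 * ‖xμ - xs‖)]
  have hd : 2 / ((d : ℝ) + 4) ≤ 1 := by
    rw [div_le_one (by positivity)]
    have : (0 : ℝ) ≤ d := by positivity
    linarith
  have hd0 : 0 ≤ 2 / ((d : ℝ) + 4) := by positivity
  refine ⟨?_, ?_⟩
  · unfold initialGap; positivity
  · have h9 : 2 / ((d : ℝ) + 4) * (objective f x0 - objective f xs) ≤
        2 / ((d : ℝ) + 4) * (smoothing μ (objective f) x0 - smoothing μ (objective f) xμ) + ρ := by
      have h10 := mul_le_mul_of_nonneg_left (show objective f x0 - objective f xs ≤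
        smoothing μ (objective f) x0 - smoothing μ (objective f) xμ + ρ by linarith) hd0
      have h11 := mul_le_mul_of_nonneg_right hd hρ0
      linarith
    have h12 : 0 ≤ 2 / ((d : ℝ) + 4) *
        (smoothing μ (objective f) x0 - smoothing μ (objective f) xμ) := mul_nonneg hd0 h1
    have h13 : 6 * L * ‖x0 - xs‖ ^ 2 ≤ 9 * L * ‖x0 - xμ‖ ^ 2 + 18 * L * (2 * ρ / τ) := by
      have h14 := mul_le_mul_of_nonneg_left h8 (by positivity : 0 ≤ 6 * L)
      have h15 := mul_le_mul_of_nonneg_left h7 (by positivity : 0 ≤ 18 * L)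
      linarith
    have e : 18 * L * (2 * ρ / τ) = 36 * L / τ * ρ := by ring
    rw [e] at h13
    unfold initialGap
    linarith

end Smoothing

/-! ### Choice of the number of epochs -/

section Complexity

variable {d n : ℕ} {L τ ε err δ D₀ : ℝ}

/-- The `5` comes from `d + 4 ≤ 5d`; the `7` covers `(log 5 + log z)/log 2 + 1`. -/
lemma natLog_two_add_one_le {m : ℕ} {z : ℝ} (hz : (m : ℝ) ≤ 5 * z) :
    ((Nat.log 2 m + 1 : ℕ) : ℝ) ≤ 7 * max 1 (Real.log z) := by
  have h1 : (1 : ℝ) ≤ max 1 (Real.log z) := le_max_left _ _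
  rcases Nat.eq_zero_or_pos m with rfl | hm
  · simp; linarith
  have hm' : (1 : ℝ) ≤ m := by exact_mod_cast hm
  have hz0 : 0 < z := by linarith
  have h2 : (2 : ℝ) ^ Nat.log 2 m ≤ m := by exact_mod_cast Nat.pow_log_le_self 2 hm.ne'
  have h3 := Real.log_le_log (by positivity) (h2.trans hz)
  rw [Real.log_pow, Real.log_mul (by norm_num) hz0.ne'] at h3
  have h4 := Real.log_two_gt_d9
  have h5 : Real.log 5 ≤ 2 := by
    rw [Real.log_le_iff_le_exp (by norm_num)]
    have h6 : (2.7 : ℝ) ^ 2 ≤ Real.exp 1 ^ 2 := by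
      have := Real.exp_one_gt_d9
      gcongr
      linarith
    rw [← Real.exp_nat_mul] at h6
    norm_num at h6
    linarith
  have h7 : Real.log z ≤ max 1 (Real.log z) := le_max_right _ _
  have h8 : (0 : ℝ) ≤ Nat.log 2 m := by positivity
  push_cast
  nlinarith

/-- Rests on `exp (α/4) ≤ 1/(1 - α/4) ≤ 1 + α/2`. -/
lemma le_one_add_half_pow {α W : ℝ} (hα : 0 < α) (hα2 : α ≤ 1 / 2) (hW : 0 < W) {k : ℕ}
    (hk : 4 / α * Real.log W ≤ k) : W ≤ (1 + α / 2) ^ k := by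
  have h1 : Real.exp (α / 4) ≤ 1 + α / 2 := by
    have h2 : 1 - α / 4 ≤ Real.exp (-(α / 4)) := by
      have := Real.add_one_le_exp (-(α / 4)); linarith
    rw [Real.exp_neg, le_inv_comm₀ (by linarith) (Real.exp_pos _)] at h2
    refine h2.trans ?_
    rw [inv_le_iff_one_le_mul₀ (by linarith)]
    nlinarith
  calc W = Real.exp (Real.log W) := (Real.exp_log hW).symm
    _ ≤ Real.exp (k * (α / 4)) := by
      gcongr
      have e : Real.log W = 4 / α * Real.log W * (α / 4) := by field_simp
      rw [e]
      gcongr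
    _ = Real.exp (α / 4) ^ k := Real.exp_nat_mul _ _
    _ ≤ _ := by gcongr

/-- `S` epochs suffice for accuracy `ε`, given the recursion of `EpochBound` and the size `D₀` of
the initial gap up to a factor and a shift by `δ`. -/
def Sufficient (d n : ℕ) (L τ ε err δ D₀ : ℝ) (S : ℕ) : Prop :=
  ∀ A D : ℕ → ℝ, (∀ s, 0 ≤ A s) → (∀ s, 0 ≤ D s) →
    (∀ s, EpochBound d n L τ err (s + 1) (A s) (D s) (A (s + 1)) (D (s + 1))) →
    2 / ((d : ℝ) + 4) * A 0 + 6 * L * D 0 ≤ 3 / 2 * D₀ + δ → A S ≤ ε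

/-- The factors `3/4` from the comparison and `5/4` from the hypothesis give `15/16 < 1`; the
remainder pays for `δ` and `err`. -/
lemma sufficient_of_le (hL : 0 < L) (hτ : 0 < τ) (herr : 0 ≤ err)
    (hδ0 : 0 ≤ δ) (hδ : (d + 4) * δ ≤ ε / 100) (herr' : err ≤ ε / 250) {S : ℕ} (hS : S ≤ s₀ d n)
    (h : (d + 4) * D₀ ≤ 5 / 4 * ε * 2 ^ S) : Sufficient d n L τ ε err δ D₀ S := by
  intro A D hA hD hb h0
  refine (gap_initial_le hL hτ herr hD hb hS).trans ?_
  have h1 : ((d : ℝ) + 4) / 2 * (2 / ((d : ℝ) + 4) * A 0 + 6 * L * D 0) ≤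
      (d + 4) / 2 * (3 / 2 * D₀ + δ) := by gcongr
  have h2 : ((d : ℝ) + 4) / 2 * (2 / ((d : ℝ) + 4) * A 0 + 6 * L * D 0) / 2 ^ S ≤ 19 / 20 * ε := by
    rw [div_le_iff₀ (by positivity)]
    have h3 : (1 : ℝ) ≤ 2 ^ S := one_le_pow₀ (by norm_num)
    have h4 : 0 ≤ ((d : ℝ) + 4) * δ := by positivity
    nlinarith
  linarith

/-- The factor `9/2` brings the contribution `9/4 · D₀/n` of `D₀` down to `ε/2` after `k`
contractions. -/
lemma sufficient_add (hn : 0 < n) (hL : 0 < L) (hτ : 0 < τ) (hε : 0 < ε) (herr : 0 ≤ err)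
    (hδ0 : 0 ≤ δ) (hδ : (d + 4) * δ ≤ ε / 100) (herr' : err ≤ ε / 250) (hD₀ : 0 < D₀) {k : ℕ}
    (h : 4 / alpha d n L τ (s₀ d n + 1) * Real.log (9 / 2 * (D₀ / (n * ε))) ≤ k) :
    Sufficient d n L τ ε err δ D₀ (s₀ d n + k) := by
  intro A D hA hD hb h0
  refine (gap_second_le hn hL hτ herr hA hD hb k).trans ?_
  have hn' : (1 : ℝ) ≤ n := by exact_mod_cast hn
  have hα := alpha_pos (d := d) hn hL hτ (s₀ d n + 1)
  have h1 := le_one_add_half_pow hα (alpha_le_half _) (by positivity) h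
  set Q := (1 + alpha d n L τ (s₀ d n + 1) / 2) ^ k with hQ
  have hQ1 : 1 ≤ Q := one_le_pow₀ (by linarith)
  have h2 : 3 / 2 * (2 / ((d : ℝ) + 4) * A 0 + 6 * L * D 0) / n / Q ≤
      3 / 2 * (3 / 2 * D₀ + δ) / n / Q := by gcongr
  have h3 : 3 / 2 * (3 / 2 * D₀ + δ) / n / Q ≤ 3 / 5 * ε := by
    rw [div_le_iff₀ (by positivity), div_le_iff₀ (by positivity)]
    have h4 : 9 / 2 * D₀ ≤ Q * (n * ε) := by
      rwa [← mul_div_assoc, div_le_iff₀ (by positivity)] at h1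
    have h5 : δ ≤ ε / 400 := by
      have : (0 : ℝ) ≤ d * δ := by positivity
      linarith
    have h6 : ε ≤ Q * (n * ε) := by
      have h8 : 1 ≤ Q * n := one_le_mul_of_one_le_of_one_le hQ1 hn'
      have := mul_le_mul_of_nonneg_right h8 hε.le
      linarith
    linarith
  linarith

/-- Three choices: fewer than or exactly `s₀` epochs if `D₀ ≤ nε`, exactly `s₀` if `D₀` is at most
`5/4 · nε`, and `s₀` plus a multiple of `log (D₀/(nε))/α` beyond that. -/
lemma exists_sufficient (hd : 0 < d) (hn : 0 < n) (hL : 0 < L) (hτ : 0 < τ) (hε : 0 < ε)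
    (herr : 0 ≤ err) (hδ0 : 0 ≤ δ) (hδ : (d + 4) * δ ≤ ε / 100) (herr' : err ≤ ε / 250)
    (hD₀ : 0 ≤ D₀) :
    ∃ S : ℕ, 22 * ((d : ℝ) * n) * S ≤ 4000 * complexityBound d n L τ ε D₀ ∧
      Sufficient d n L τ ε err δ D₀ S := by
  have hd' : (1 : ℝ) ≤ d := by exact_mod_cast hd
  have hn' : (1 : ℝ) ≤ n := by exact_mod_cast hn
  have hs₀ : ((s₀ d n : ℕ) : ℝ) ≤ 7 * max 1 (Real.log (d * n)) :=
    natLog_two_add_one_le (by push_cast; nlinarith)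
  by_cases h1 : D₀ / ε ≤ n
  -- The power `2^S` exceeds `(d+4)D₀/ε`. For `D₀ = 0` the floor and its `Nat.log` are `0`, giving
  -- one epoch.
  · refine ⟨Nat.log 2 ⌊((d : ℝ) + 4) * D₀ / ε⌋₊ + 1, ?_, ?_⟩
    · have h2 : ((⌊((d : ℝ) + 4) * D₀ / ε⌋₊ : ℕ) : ℝ) ≤ 5 * (d * D₀ / ε) := by
        refine (Nat.floor_le (by positivity)).trans ?_
        rw [show 5 * ((d : ℝ) * D₀ / ε) = 5 * d * D₀ / ε by ring]
        gcongr
        linarith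
      have h3 := natLog_two_add_one_le h2
      rw [complexityBound, if_pos (Or.inl h1)]
      have h4 := mul_le_mul_of_nonneg_left h3 (by positivity : 0 ≤ 22 * ((d : ℝ) * n))
      have h5 : 0 ≤ (d : ℝ) * n * max 1 (Real.log (d * D₀ / ε)) := by positivity
      linarith
    · refine sufficient_of_le hL hτ herr hδ0 hδ herr' ?_ ?_
      · rw [s₀]
        gcongr
        refine Nat.floor_le_of_le ?_
        push_cast
        rw [mul_div_assoc]
        gcongr
      · have h2 : ((d : ℝ) + 4) * D₀ / ε ≤
            2 ^ (Nat.log 2 ⌊((d : ℝ) + 4) * D₀ / ε⌋₊ + 1) := by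
          refine (Nat.lt_floor_add_one _).le.trans ?_
          exact_mod_cast Nat.lt_pow_succ_log_self (by norm_num : 1 < 2) ⌊((d : ℝ) + 4) * D₀ / ε⌋₊
        rw [div_le_iff₀ hε] at h2
        have h3 : 0 < (2 : ℝ) ^ (Nat.log 2 ⌊((d : ℝ) + 4) * D₀ / ε⌋₊ + 1) * ε := by positivity
        linarith
  have h1' : (n : ℝ) < D₀ / ε := not_le.1 h1
  have hw : 1 < D₀ / (n * ε) := by
    rw [lt_div_iff₀ (by positivity), one_mul]
    exact (lt_div_iff₀ hε).1 h1'
  have hD₀' : 0 < D₀ := by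
    rcases hD₀.eq_or_lt with h | h
    · rw [← h] at hw; simp at hw; linarith
    · exact h
  have hlog0 : 0 < Real.log (D₀ / (n * ε)) := Real.log_pos hw
  have hn0 : (0 : ℝ) < n := by linarith
  have hd0 : (0 : ℝ) < d := by linarith
  -- comparison with the logarithm in the first regime
  have hmax : max 1 (Real.log (d * n)) ≤ max 1 (Real.log (d * D₀ / ε)) := by
    gcongr
    rw [mul_div_assoc]
    gcongr
  have hlogle : Real.log (D₀ / (n * ε)) ≤ max 1 (Real.log (d * D₀ / ε)) := by
    refine le_trans ?_ (le_max_right _ _)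
    refine Real.log_le_log (by positivity) ?_
    rw [div_le_div_iff₀ (by positivity) hε]
    have : (1 : ℝ) ≤ d * n := one_le_mul_of_one_le_of_one_le hd' hn'
    have h2 := mul_le_mul_of_nonneg_right this (by positivity : 0 ≤ D₀ * ε)
    linarith
  -- The logarithm `log (D₀/(nε))` can pay for epochs of the second phase only when it is bounded
  -- away from `0`.
  by_cases h2 : D₀ / (n * ε) ≤ 5 / 4
  · refine ⟨s₀ d n, ?_, sufficient_of_le hL hτ herr hδ0 hδ herr' le_rfl ?_⟩
    · have h4 := mul_le_mul_of_nonneg_left hs₀ (by positivity : 0 ≤ 22 * ((d : ℝ) * n))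
      have h5 : 0 ≤ (d : ℝ) * n * max 1 (Real.log (d * n)) := by positivity
      rw [complexityBound]
      split_ifs with h3
      · have h6 := mul_le_mul_of_nonneg_left hmax (by positivity : 0 ≤ (d : ℝ) * n)
        linarith
      · have h6 : 0 ≤ d * Real.sqrt (n * L / τ) * Real.log (D₀ / (n * ε)) := by positivity
        linarith
    · have h3 : ((d : ℝ) + 4) * n ≤ 2 ^ s₀ d n := by exact_mod_cast le_two_pow_s₀ d n
      rw [div_le_iff₀ (by positivity)] at h2
      calc ((d : ℝ) + 4) * D₀ ≤ (d + 4) * (5 / 4 * (n * ε)) := by gcongr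
        _ = 5 / 4 * ε * ((d + 4) * n) := by ring
        _ ≤ _ := by gcongr
  have h2' : 5 / 4 < D₀ / (n * ε) := not_le.1 h2
  have hα := alpha_pos (d := d) hn hL hτ (s₀ d n + 1)
  -- Absorbs the constant `9/2` into the logarithm, as `(5/4)^7 ≥ 9/2`.
  have hlog45 : Real.log (9 / 2) ≤ 7 * Real.log (D₀ / (n * ε)) := by
    have h3 : Real.log (9 / 2) ≤ Real.log ((5 / 4) ^ 7) :=
      Real.log_le_log (by norm_num) (by norm_num)
    have h4 : Real.log ((5 / 4) ^ 7) = 7 * Real.log (5 / 4) := by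
      rw [Real.log_pow]; norm_num
    have h5 : Real.log (5 / 4) ≤ Real.log (D₀ / (n * ε)) := Real.log_le_log (by norm_num) h2'.le
    linarith
  set ℓ := Real.log (D₀ / (n * ε)) with hℓ
  have hlogsum : Real.log (9 / 2 * (D₀ / (n * ε))) = Real.log (9 / 2) + ℓ :=
    Real.log_mul (by norm_num) (by positivity)
  set α := alpha d n L τ (s₀ d n + 1) with hαdef
  set k := ⌈4 / α * Real.log (9 / 2 * (D₀ / (n * ε)))⌉₊ with hk
  have hkle : (k : ℝ) ≤ 32 / α * ℓ + 1 := by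
    have h3 : 4 / α * Real.log (9 / 2 * (D₀ / (n * ε))) ≤ 32 / α * ℓ := by
      calc _ ≤ 4 / α * (8 * ℓ) := by
            gcongr
            rw [hlogsum]; linarith
        _ = _ := by ring
    have h4 : 0 ≤ 4 / α * Real.log (9 / 2 * (D₀ / (n * ε))) := by
      have : 0 ≤ Real.log (9 / 2) := Real.log_nonneg (by norm_num)
      rw [hlogsum]; positivity
    exact (Nat.ceil_lt_add_one h4).le.trans (by linarith)
  refine ⟨s₀ d n + k, ?_,
    sufficient_add hn hL hτ hε herr hδ0 hδ herr' hD₀' (Nat.le_ceil _)⟩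
  have hαe : α = min (Real.sqrt (n * τ / (24 * L))) (1 / 2) := alpha_of_lt (Nat.lt_succ_self _)
  rw [complexityBound]
  push_cast
  split_ifs with h3
  · have h4 := h3.resolve_left h1
    -- The condition `n ≥ 6L/τ` is exactly `nτ/(24L) ≥ 1/4`.
    have hα2 : α = 1 / 2 := by
      rw [hαe]
      refine min_eq_right (Real.le_sqrt_of_sq_le ?_)
      rw [div_le_iff₀ hτ] at h4
      rw [le_div_iff₀ (by positivity)]
      linarith
    rw [hα2] at hkle
    have h5 : (s₀ d n : ℝ) + k ≤ 72 * max 1 (Real.log (d * D₀ / ε)) := by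
      have : (1 : ℝ) ≤ max 1 (Real.log (d * D₀ / ε)) := le_max_left _ _
      norm_num at hkle
      linarith
    have h6 := mul_le_mul_of_nonneg_left h5 (by positivity : 0 ≤ 22 * ((d : ℝ) * n))
    have h7 : 0 ≤ (d : ℝ) * n * max 1 (Real.log (d * D₀ / ε)) := by positivity
    linarith
  · have h4 : (n : ℝ) < 6 * L / τ := not_le.1 fun h => h3 (Or.inr h)
    have hα2 : α = Real.sqrt (n * τ / (24 * L)) := by
      rw [hαe]
      refine min_eq_left (Real.sqrt_le_iff.2 ⟨by norm_num, ?_⟩)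
      rw [lt_div_iff₀ hτ] at h4
      rw [div_le_iff₀ (by positivity)]
      linarith
    -- Here `n/α = √24 · √(nL/τ)`, which converts `dn/α` into the accelerated rate.
    have h5 : (n : ℝ) / α ≤ 5 * Real.sqrt (n * L / τ) := by
      rw [div_le_iff₀ hα, hα2, mul_assoc, ← Real.sqrt_mul (by positivity)]
      have e : n * L / τ * (n * τ / (24 * L)) = n ^ 2 * (1 / 24) := by field_simp
      rw [e, Real.sqrt_mul (by positivity), Real.sqrt_sq hn0.le]
      have h6 : 1 / 5 ≤ Real.sqrt (1 / 24) := Real.le_sqrt_of_sq_le (by norm_num)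
      nlinarith
    have h7 : (d : ℝ) * n * (32 / α * ℓ) ≤ 160 * (d * Real.sqrt (n * L / τ) * ℓ) := by
      calc (d : ℝ) * n * (32 / α * ℓ) = 32 * d * ℓ * (n / α) := by ring
        _ ≤ 32 * d * ℓ * (5 * Real.sqrt (n * L / τ)) := by gcongr
        _ = _ := by ring
    have h8 : (1 : ℝ) ≤ max 1 (Real.log (d * n)) := le_max_left _ _
    have h9 := mul_le_mul_of_nonneg_left (show (s₀ d n : ℝ) + k ≤
      8 * max 1 (Real.log (d * n)) + 32 / α * ℓ by linarith)
      (by positivity : 0 ≤ 22 * ((d : ℝ) * n))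
    have h10 : 0 ≤ (d : ℝ) * n * max 1 (Real.log (d * n)) := by positivity
    have h11 : 0 ≤ d * Real.sqrt (n * L / τ) * ℓ := by positivity
    linarith

end Complexity

lemma exists_forall_mul_sq_le (c : ℝ) {η : ℝ} (hη : 0 < η) :
    ∃ m : ℝ, 0 < m ∧ ∀ x, 0 < x → x ≤ m → c * x ^ 2 ≤ η := by
  refine ⟨min 1 (η / (|c| + 1)), by positivity, fun x hx hxm => ?_⟩
  have h1 : x ≤ 1 := hxm.trans (min_le_left _ _)
  have h2 : x * (|c| + 1) ≤ η := (le_div_iff₀ (by positivity)).1 (hxm.trans (min_le_right _ _))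
  calc c * x ^ 2 ≤ |c| * x ^ 2 := by gcongr; exact le_abs_self c
    _ ≤ |c| * x := by gcongr; nlinarith
    _ ≤ η := by linarith

end

end ZOVarag

/-! ### Assembly of the complexity bound -/

theorem corollary2 :
    ∃ C : ℝ, 0 < C ∧
      ∀ (d n : ℕ) (L τ ε : ℝ), 0 < d → 0 < n → 0 < L → 0 < τ → 0 < ε →
        ∃ μmax νmax : ℝ, 0 < μmax ∧ 0 < νmax ∧
          ∀ (f : Fin n → Eucl d → ℝ) (x0 : Eucl d),
            ZOVarag.SmoothConvex f L →
            ZOVarag.StronglyConvex (ZOVarag.objective f) τ →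
            ∃ xstar : Eucl d, IsMinOn (ZOVarag.objective f) Set.univ xstar ∧
              ∀ μ ν : ℝ, 0 < μ → μ ≤ μmax → 0 < ν → ν ≤ νmax →
                ∃ xμ : Eucl d,
                  IsMinOn (ZOVarag.smoothing μ (ZOVarag.objective f)) Set.univ xμ ∧
                  ∃ S : ℕ,
                    (∀ ξ : ℕ → ℕ → Eucl d × Fin n,
                      (((ZOVarag.zoVarag L τ μ ν x0 S ξ).queries f : ℕ) : ℝ) ≤
                        C * ZOVarag.complexityBound d n L τ ε
                          (ZOVarag.initialGap f L μ x0 xμ)) ∧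
                    ∀ (Ω : Type*) [MeasurableSpace Ω] (P : MeasureTheory.Measure Ω)
                      [MeasureTheory.IsProbabilityMeasure P]
                      (ξ : ℕ → ℕ → Ω → Eucl d × Fin n),
                      ZOVarag.IsSampling P ξ →
                        MeasureTheory.Integrable (fun ω =>
                          ZOVarag.objective f
                            ((ZOVarag.zoVarag L τ μ ν x0 S (fun s t => ξ s t ω)).eval f)
                          - ZOVarag.objective f xstar) P ∧
                        ∫ ω, (ZOVarag.objective f
                            ((ZOVarag.zoVarag L τ μ ν x0 S (fun s t => ξ s t ω)).eval f)
                          - ZOVarag.objective f xstar) ∂P ≤ ε := by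
  -- The largest coefficient that arises is `22 · 160 = 3520`, at the accelerated term.
  refine ⟨4000, by norm_num, fun d n L τ ε hd hn hL hτ hε => ?_⟩
  set M2 := ∫ u, ‖u‖ ^ 2 ∂(stdGaussian (Eucl d)) with hM2
  set M6 := ∫ u, ‖u‖ ^ 6 ∂(stdGaussian (Eucl d)) with hM6
  -- The threshold `m₁` controls the shift `δ` between the gaps of `f` and `f_μ`; `m₂` and `m₃` each
  -- allow half of the error level `ε/250`.
  obtain ⟨m₁, hm₁, hμ₁⟩ := ZOVarag.exists_forall_mul_sq_le
    ((d + 4) * ((2 + 36 * L / τ) * (L / 2 * M2))) (by positivity : 0 < ε / 100)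
  obtain ⟨m₂, hm₂, hμ₂⟩ := ZOVarag.exists_forall_mul_sq_le
    (2 * L ^ 2 * M6 / τ) (by positivity : 0 < ε / 500)
  obtain ⟨m₃, hm₃, hν₃⟩ := ZOVarag.exists_forall_mul_sq_le
    ((d * L) ^ 2 / 2 / τ) (by positivity : 0 < ε / 500)
  refine ⟨min m₁ m₂, m₃, lt_min hm₁ hm₂, hm₃, fun f x0 hf hs => ?_⟩
  have hcont := hf.differentiable_objective.continuous
  obtain ⟨xs, hxs⟩ := hs.exists_isMinOn hτ hcont fun _ => le_rfl
  refine ⟨xs, hxs, fun μ ν hμ0 hμ hν0 hν => ?_⟩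
  have hsm := fun x => ZOVarag.smoothing_sub_bounds (μ := μ) hf.convexOn_objective
    hf.differentiable_objective (hf.gradient_objective_lipschitz hn) x
  have hcs : Continuous (ZOVarag.smoothing μ (ZOVarag.objective f)) := by
    rw [← continuousOn_univ]
    exact (ZOVarag.convexOn_smoothing hf.convexOn_objective fun x => (hsm x).1).continuousOn isOpen_univ
  -- Strong convexity of `f_μ` is not needed: `f ≤ f_μ` already makes `f_μ` coercive.
  obtain ⟨xμ, hxμ⟩ := hs.exists_isMinOn hτ hcs fun x => (hsm x).2.1
  refine ⟨xμ, hxμ, ?_⟩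
  have hset : ZOVarag.Setting f L τ μ ν xs := ⟨hn, hL, hτ, hμ0, hν0, hf, hs, hxs⟩
  obtain ⟨hD₀, hgap⟩ := ZOVarag.initialGap_comparison hf hs hn hL hτ hxs hxμ x0
  rw [← hM2] at hgap
  have hM20 : 0 ≤ M2 := integral_nonneg fun u => by positivity
  have herr : ZOVarag.errLevel d L τ μ ν ≤ ε / 250 := by
    have h2 := hμ₂ μ hμ0 (hμ.trans (min_le_right _ _))
    have h3 := hν₃ ν hν0 hν
    have e : ZOVarag.errLevel d L τ μ ν =
        2 * L ^ 2 * M6 / τ * μ ^ 2 + (d * L) ^ 2 / 2 / τ * ν ^ 2 := by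
      rw [ZOVarag.errLevel, ← hM6]; ring
    rw [e]; linarith
  obtain ⟨S, hS, hsuff⟩ := ZOVarag.exists_sufficient (d := d) (n := n) (L := L) (τ := τ)
    (err := ZOVarag.errLevel d L τ μ ν)
    (δ := (2 + 36 * L / τ) * (L / 2 * μ ^ 2 * M2)) hd hn hL hτ hε (ZOVarag.errLevel_nonneg hτ)
    (by positivity)
    (by
      have h1 := hμ₁ μ hμ0 (hμ.trans (min_le_left _ _))
      refine le_trans (le_of_eq ?_) h1
      ring) herr hD₀
  refine ⟨S, fun ξ => ?_, fun Ω _ P _ ξ hξ => ?_⟩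
  · have h1 : (((ZOVarag.zoVarag L τ μ ν x0 S ξ).queries f : ℕ) : ℝ) ≤
        ((22 * (d * n) * S : ℕ) : ℝ) := by
      exact_mod_cast ZOVarag.queries_zoVarag_le f hd hn L τ μ ν x0 ξ S
    push_cast at h1
    exact h1.trans hS
  · obtain ⟨A, D, hA0, hD0, hA, hD, hb, hint⟩ := hset.epochBounds hξ x0
    simp only [ZOVarag.eval_zoVarag]
    refine ⟨(hint S).1, (hint S).2.trans_le (hsuff A D hA hD hb ?_)⟩
    rw [hA0, hD0]
    exact hgap
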